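/- Consider the map $f_R(x)=R-x^2$ and let $n\ge 1$. An $n$-cycle is a periodic orbit of exact period $n$. For an indeterminate $R$, let $$P_n(R,\lambda)=\prod_{c}(\lambda-\lambda_c)\in\mathbb{C}[R][\lambda],$$ where $c$ runs over all $n$-cycles of $f_R$ in an algebraic closure of $\mathbb{C}(R)$, each counted once, and $\lambda_c=\prod_{x\in c}(-2x)$ is the multiplier of $c$. Let $$D_n(R)=\prod_{\substack{cd=n\\ c>1}}\ \prod_{\substack{1\le k\le c\\ (k,c)=1}}P_d\!\left(R,e^{2\pi i k/c}\right).$$ Call $R_0\in\mathbb{C}$ the onset of an original $n$-cycle if $f_{R_0}$ has a cycle of exact period $n$ along which $(f_{R_0}^n)'=1$. Call $R_0$ a branching parameter of the $n$-cycles if some point $x$ of a $d$-cycle of $f_{R_0}$, with $d\mid n$ and $d<n$, is a limit of points of $n$-cycles of $f_R$ for parameters $R\to R_0$. Then $P_n(R,1)$ and $D_n(R)$ are nonzero polynomials in $R$, $D_n(R)$ divides $P_n(R,1)$ in $\mathbb{C}[R]$, and $$S_n(R)=\frac{P_n(R,1)}{D_n(R)}$$ is the factor of $P_n(R,1)$ coming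 from the original (non-branched) $n$-cycles: each onset $R_0$ of an original $n$-cycle is a zero of $S_n$ with the same multiplicity as in $P_n(R,1)$, and $S_n$ has no other zeros. The zeros of the removed factor $D_n$ are exactly the branching parameters of the $n$-cycles. -/

import Mathlib

open Polynomial Function

noncomputable section

namespace LogisticCycles

/-- The simplified logistic map `x ↦ R - x ^ 2`. -/
def logisticMap {A : Type*} [CommRing A] (R x : A) : A := R - x ^ 2

open Classical in
/-- The `n`-cycles of the map with parameter `R`, each recorded once, as the set of its points. -/
def cycles {A : Type*} [CommRing A] (R : A) (n : ℕ) : Set (Finset A) :=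
  {s | ∃ x : A, minimalPeriod (logisticMap R) x = n ∧
    s = (Finset.range n).image fun i => (logisticMap R)^[i] x}

/-- The multiplier `Λ = f'(x₁) ⋯ f'(xₙ)` of a cycle, where `f'(x) = -2 x`. -/
def cycleMultiplier {A : Type*} [CommRing A] (s : Finset A) : A := ∏ x ∈ s, (-2 * x)

/-- An algebraic closure of the field `ℂ(R)`; the cycles for an indeterminate parameter `R` have
their points in this field. -/
abbrev GenericField : Type := AlgebraicClosure (RatFunc ℂ)

/-- The indeterminate parameter `R`. -/
def genericR : GenericField := algebraMap ℂ[X] GenericField X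

/-- The `n`-th iterate of the map as a polynomial in `x` over `ℂ[R]`. -/
def iterPoly (n : ℕ) : ℂ[X][X] := (fun p => C X - p ^ 2)^[n] X

lemma iterPoly_succ (n : ℕ) : iterPoly (n + 1) = C X - iterPoly n ^ 2 := by
  simp only [iterPoly, iterate_succ_apply']

lemma iterPoly_degree (n : ℕ) : (iterPoly n).natDegree = 2 ^ n := by
  induction n with
  | zero => simp [iterPoly]
  | succ k ih =>
    rw [iterPoly_succ, natDegree_sub_eq_right_of_natDegree_lt, natDegree_pow, ih]
    · ring
    · rw [natDegree_C, natDegree_pow, ih]; positivity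

lemma iterPoly_leadingCoeff (n : ℕ) : (iterPoly (n + 1)).leadingCoeff = -1 := by
  have key : ∀ k, (iterPoly k).leadingCoeff ^ 2 = 1 := by
    intro k
    induction k with
    | zero => simp [iterPoly]
    | succ k ih =>
      have h : (C (X : ℂ[X])).degree < (iterPoly k ^ 2).degree := by
        apply degree_lt_degree
        rw [natDegree_C, natDegree_pow, iterPoly_degree]; positivity
      rw [iterPoly_succ, leadingCoeff_sub_of_degree_lt' h, leadingCoeff_pow, ih]; simp
  have h : (C (X : ℂ[X])).degree < (iterPoly n ^ 2).degree := by
    apply degree_lt_degree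
    rw [natDegree_C, natDegree_pow, iterPoly_degree]; positivity
  rw [iterPoly_succ, leadingCoeff_sub_of_degree_lt' h, leadingCoeff_pow, key]

lemma iterPoly_monic (n : ℕ) : (X - iterPoly (n + 1)).Monic := by
  have h : (X : ℂ[X][X]).degree < (iterPoly (n + 1)).degree := by
    apply degree_lt_degree
    rw [natDegree_X, iterPoly_degree]; exact Nat.one_lt_two_pow (by omega)
  rw [Monic, leadingCoeff_sub_of_degree_lt' h, iterPoly_leadingCoeff, neg_neg]

lemma iterPoly_aeval (n : ℕ) (x : GenericField) :
    aeval x (iterPoly n) = (logisticMap genericR)^[n] x := by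
  induction n with
  | zero => simp [iterPoly]
  | succ k ih =>
    rw [iterPoly_succ, iterate_succ_apply', ← ih]
    simp [logisticMap, genericR]

lemma aeval_of_minimalPeriod {n : ℕ} {x : GenericField}
    (hx : minimalPeriod (logisticMap genericR) x = n + 1) :
    aeval x (X - iterPoly (n + 1)) = 0 := by
  rw [map_sub, iterPoly_aeval, aeval_X, ← hx, iterate_minimalPeriod, sub_self]

lemma cycles_finite (n : ℕ) : (cycles genericR n).Finite := by
  classical
  cases n with
  | zero =>
    refine (Set.finite_singleton (∅ : Finset GenericField)).subset ?_
    rintro s ⟨x, -, rfl⟩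
    simp
  | succ n =>
    have hfin : {x : GenericField | minimalPeriod (logisticMap genericR) x = n + 1}.Finite := by
      refine ((X - iterPoly (n + 1)).rootSet_finite GenericField).subset ?_
      intro x hx
      rw [mem_rootSet']
      exact ⟨((iterPoly_monic n).map _).ne_zero, aeval_of_minimalPeriod hx⟩
    refine (hfin.image fun x => (Finset.range (n + 1)).image
      fun i => (logisticMap genericR)^[i] x).subset ?_
    rintro s ⟨x, hx, rfl⟩
    refine ⟨x, hx, ?_⟩
    ext; simp

/-- The product `∏ (λ - λ_c)` over all `n`-cycles `c` for an indeterminate `R`. -/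
def genericCyclePoly (n : ℕ) : GenericField[X] :=
  ∏ s ∈ (cycles_finite n).toFinset, (X - C (cycleMultiplier s))

lemma isIntegral_of_mem_cycle {n : ℕ} {s : Finset GenericField} (hs : s ∈ cycles genericR n)
    {y : GenericField} (hy : y ∈ s) : IsIntegral ℂ[X] y := by
  obtain ⟨x, hx, rfl⟩ := hs
  simp only [Finset.mem_image, Finset.mem_range] at hy
  obtain ⟨i, hi, rfl⟩ := hy
  obtain ⟨n, rfl⟩ : ∃ m, n = m + 1 := ⟨n - 1, by omega⟩
  have hxi : IsIntegral ℂ[X] x := ⟨_, iterPoly_monic n, aeval_of_minimalPeriod hx⟩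
  rw [← iterPoly_aeval]
  exact IsIntegral.of_mem_of_fg (Algebra.adjoin ℂ[X] {x}) hxi.fg_adjoin_singleton _
    (aeval_mem_adjoin_singleton _ _)

lemma isIntegral_coeff_genericCyclePoly (n i : ℕ) :
    IsIntegral ℂ[X] ((genericCyclePoly n).coeff i) := by
  have h : genericCyclePoly n ∈ lifts (algebraMap (integralClosure ℂ[X] GenericField)
      GenericField) := by
    refine Subsemiring.prod_mem _ fun s hs => ?_
    have hs' := (cycles_finite n).mem_toFinset.1 hs
    have hm : IsIntegral ℂ[X] (cycleMultiplier s) := by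
      refine IsIntegral.prod _ fun y hy => ?_
      have h2 : IsIntegral ℂ[X] (-2 : GenericField) := by
        have := (isIntegral_algebraMap (R := ℂ[X]) (A := GenericField) (x := -2))
        rwa [map_neg, map_ofNat] at this
      exact h2.mul (isIntegral_of_mem_cycle hs' hy)
    refine ⟨X - C ⟨cycleMultiplier s, hm⟩, ?_⟩
    simp
  obtain ⟨y, hy⟩ := (lifts_iff_coeff_lifts _).1 h i
  rw [← hy]
  exact y.2

lemma genericR_fixed (σ : GenericField ≃ₐ[RatFunc ℂ] GenericField) : σ genericR = genericR := by
  rw [genericR, IsScalarTower.algebraMap_apply ℂ[X] (RatFunc ℂ) GenericField, σ.commutes]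

open Classical in
lemma image_mem_cycles (σ : GenericField ≃ₐ[RatFunc ℂ] GenericField) {n : ℕ}
    {s : Finset GenericField} (hs : s ∈ cycles genericR n) : s.image σ ∈ cycles genericR n := by
  obtain ⟨x, hx, rfl⟩ := hs
  have hsc : Semiconj σ (logisticMap genericR) (logisticMap genericR) := by
    intro y
    simp [logisticMap, genericR_fixed]
  refine ⟨σ x, ?_, ?_⟩
  · rw [← hx]
    apply minimalPeriod_eq_minimalPeriod_iff.2
    intro m
    rw [IsPeriodicPt, IsPeriodicPt, IsFixedPt, IsFixedPt, ← (hsc.iterate_right m).eq]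
    exact σ.injective.eq_iff
  · rw [Finset.image_image]
    refine Finset.image_congr fun i _ => ?_
    exact (hsc.iterate_right i).eq x

lemma genericCyclePoly_map (σ : GenericField ≃ₐ[RatFunc ℂ] GenericField) (n : ℕ) :
    (genericCyclePoly n).map (σ : GenericField →+* GenericField) = genericCyclePoly n := by
  classical
  rw [genericCyclePoly, Polynomial.map_prod]
  refine Finset.prod_bij' (fun s _ => s.image σ) (fun s _ => s.image σ.symm) ?_ ?_ ?_ ?_ ?_
  · intro s hs
    rw [Set.Finite.mem_toFinset] at hs ⊢
    exact image_mem_cycles σ hs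
  · intro s hs
    rw [Set.Finite.mem_toFinset] at hs ⊢
    exact image_mem_cycles σ.symm hs
  · intro s _
    simp [Finset.image_image, Function.comp_def]
  · intro s _
    simp [Finset.image_image, Function.comp_def]
  · intro s _
    have h : σ (cycleMultiplier s) = cycleMultiplier (s.image σ) := by
      rw [cycleMultiplier, cycleMultiplier, Finset.prod_image σ.injective.injOn, map_prod]
      refine Finset.prod_congr rfl fun x _ => ?_
      rw [map_mul, map_neg, map_ofNat]
    rw [← h]
    simp

/-- The product over the cycles has its coefficients in `ℂ[R]`. -/
lemma exists_cyclePoly (n : ℕ) :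
    ∃ P : ℂ[X][X], P.map (algebraMap ℂ[X] GenericField) = genericCyclePoly n := by
  have h : genericCyclePoly n ∈ lifts (algebraMap ℂ[X] GenericField) := by
    rw [lifts_iff_coeff_lifts]
    intro i
    have h1 : (genericCyclePoly n).coeff i ∈ Set.range (algebraMap (RatFunc ℂ) GenericField) := by
      rw [InfiniteGalois.mem_range_algebraMap_iff_fixed]
      intro σ
      conv_rhs => rw [← genericCyclePoly_map σ n]
      simp
    obtain ⟨y, hy⟩ := h1
    have h2 : IsIntegral ℂ[X] y := by
      have := isIntegral_coeff_genericCyclePoly n i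
      rw [← hy] at this
      exact (isIntegral_algebraMap_iff (algebraMap (RatFunc ℂ) GenericField).injective).1 this
    obtain ⟨z, hz⟩ := IsIntegrallyClosed.isIntegral_iff.1 h2
    exact ⟨z, by rw [IsScalarTower.algebraMap_apply ℂ[X] (RatFunc ℂ) GenericField, hz, hy]⟩
  exact h

/-- The polynomial `P_n(R, λ) = ∏ (λ - λ_c)`, the product over all `n`-cycles `c` of the map.
It is a polynomial in the outer variable `λ` whose coefficients are polynomials in `R`. -/
def cyclePoly (n : ℕ) : ℂ[X][X] := (exists_cyclePoly n).choose

/-- This determines `cyclePoly n`, as `ℂ[R]` embeds into `GenericField`. -/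
lemma cyclePoly_spec (n : ℕ) :
    (cyclePoly n).map (algebraMap ℂ[X] GenericField) =
      ∏ s ∈ (cycles_finite n).toFinset, (X - C (cycleMultiplier s)) :=
  (exists_cyclePoly n).choose_spec

/-- The polynomial `P_n(R, z)` in `R`, for a complex number `z`. -/
def cyclePolyAt (n : ℕ) (z : ℂ) : ℂ[X] := (cyclePoly n).eval (C z)

/-- The product of `P_d(R, e^{2πik/c})` over all factorizations `c d = n` with `c > 1` and all
`1 ≤ k ≤ c` coprime to `c`. -/
def branchedFactor (n : ℕ) : ℂ[X] :=
  ∏ p ∈ n.divisorsAntidiagonal with 1 < p.1,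
    ∏ k ∈ Finset.Icc 1 p.1 with Nat.Coprime k p.1,
      cyclePolyAt p.2 (Complex.exp (2 * k * Real.pi * Complex.I / p.1))

/-- At the parameter `R₀` the `n`-cycles branch off a shorter cycle: some point of a `d`-cycle,
where `d ∣ n` and `d < n`, is a limit of points of `n`-cycles for parameters that tend to `R₀`. -/
def IsBranchingParam (n : ℕ) (R₀ : ℂ) : Prop :=
  ∃ x : ℂ, minimalPeriod (logisticMap R₀) x ∣ n ∧ minimalPeriod (logisticMap R₀) x < n ∧
    (R₀, x) ∈ closure {q : ℂ × ℂ | minimalPeriod (logisticMap q.1) q.2 = n}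

/-- `R₀` is the onset of an original `n`-cycle: at `R₀` there is an `n`-cycle, its period being
exactly `n` (so that it has not merged there with a shorter cycle), along which the derivative
of the `n`-th iterate is `1`. -/
def IsOriginalOnset (n : ℕ) (R₀ : ℂ) : Prop :=
  ∃ x : ℂ, minimalPeriod (logisticMap R₀) x = n ∧ deriv ((logisticMap R₀)^[n]) x = 1

/-- `S` is the factor of the onset polynomial `P_n(R, 1)` that comes from the original `n`-cycles:
it collects, with their full multiplicities in `P_n(R, 1)`, the onset parameters of original
`n`-cycles, and no others. This fixes `S` up to a nonzero constant. -/
structure IsOriginalFactor (n : ℕ) (S : ℂ[X]) : Prop where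
  ne_zero : S ≠ 0
  dvd : S ∣ cyclePolyAt n 1
  mult_of_original : ∀ R₀ : ℂ, IsOriginalOnset n R₀ →
    S.rootMultiplicity R₀ = (cyclePolyAt n 1).rootMultiplicity R₀
  mult_of_not_original : ∀ R₀ : ℂ, ¬ IsOriginalOnset n R₀ → S.rootMultiplicity R₀ = 0

end LogisticCycles

end

/-! Two ingredients are combined: Fatou's count of parabolic petals and a valuation comparison over
the integral closure `IntRing` of ℂ[R].

Petals. If x is a zero of multiplicity k + 1 of x - f^n(x), then k disjoint attracting petals,
invariant under f^n, sit at x. Each of them meets the orbit of the only critical point 0, and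
distinct petals meet it at times in different residue classes mod n. So the excess multiplicities of
the fixed points of f^n add up to at most n (`sum_rootMultiplicity_sub_one_le`).

Collapses. A `Specialization` at R₀ reduces generic periodic points to complex ones. A generic
n-cycle can reduce to a d-cycle with d < n only if the multiplier of the latter is a primitive
(n/d)-th root of unity, and each such root of unity does produce a collapse
(`isPrimitiveRoot_of_collapse`, `exists_collapse`). So the zeros of the removed factor are the
parameters at which an n-cycle collapses.

Multiplicities. Let n = d c and let an n-cycle collapse onto a d-cycle. Over each of the d points
lie at least c + 1 generic fixed points of f^n, which already uses up the d c available petals.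
Hence there are exactly c + 1 of them, and no other cycle has multiplier 1 under f^n. Let a be on
the n-cycle, let y be the generic point of period d over the same point, and let μ be the limit of
the multiplier λ of y. Writing 1 minus a multiplier as a product of differences of fixed points
(`one_sub_orbitMul`) shows that 1 - λ_a and 1 - λ^c both have the valuation of (a - y)^c, while 1 -
λ^c and μ - λ differ by a unit. So D_n and P_n(R, 1) have the same order at each zero of D_n
(`rootMultiplicity_eq_of_isRoot`). This gives divisibility, and the quotient keeps exactly the
original onsets. The description by limits follows from the dynatomic polynomial, whose zeros depend
continuously on R. -/

noncomputable section

namespace LogisticCycles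

/-! ### Inverse branches and the critical orbit -/

-- Simple connectivity gives a continuous root h. It is differentiable because its slope is that of
-- g divided by h z + h w, which tends to 2 h w ≠ 0.
open Set Metric in
lemma exists_holomorphic_sqrt {U : Set ℂ} (hc : Convex ℝ U) (hne : U.Nonempty) (ho : IsOpen U)
    {g : ℂ → ℂ} (hg : DifferentiableOn ℂ g U) (h0 : ∀ w ∈ U, g w ≠ 0) :
    ∃ h : ℂ → ℂ, DifferentiableOn ℂ h U ∧ ∀ w, h w ^ 2 = g w := by
  have hs : IsSimplyConnected U := by
    have := hc.contractibleSpace hne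
    exact (inferInstance : SimplyConnectedSpace U)
  obtain ⟨h, hcont, hsq⟩ := Complex.exists_continuousOn_pow_eq hs ho hg.continuousOn
    (by rintro ⟨w, hw, hw0⟩; exact h0 w hw hw0) two_ne_zero
  refine ⟨h, fun w hw => ?_, hsq⟩
  have hh : h w ≠ 0 := by
    intro hh
    apply h0 w hw
    rw [← hsq, hh]; simp
  have hcw : ContinuousAt h w := hcont.continuousAt (ho.mem_nhds hw)
  have hgw : HasDerivAt g (deriv g w) w := (hg.differentiableAt (ho.mem_nhds hw)).hasDerivAt
  have key : HasDerivAt h (deriv g w / (h w + h w)) w := by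
    rw [hasDerivAt_iff_tendsto_slope] at hgw ⊢
    have hlim : Filter.Tendsto (fun z => h z + h w) (nhdsWithin w {w}ᶜ) (nhds (h w + h w)) :=
      ((hcw.tendsto.add_const _).mono_left nhdsWithin_le_nhds)
    have hne2 : h w + h w ≠ 0 := by rw [← two_mul]; exact mul_ne_zero two_ne_zero hh
    refine (hgw.div hlim hne2).congr' ?_
    filter_upwards [hlim.eventually_ne hne2] with z hz
    simp only [Pi.div_apply, slope_def_field, ← hsq]
    by_cases hzw : z - w = 0
    · simp [hzw]
    · field_simp
      ring
  exact key.differentiableAt.differentiableWithinAt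

lemma norm_le_norm_logisticMap {R z : ℂ} (h2 : 2 ≤ ‖z‖) (hR : ‖R‖ ≤ ‖z‖) :
    ‖z‖ ≤ ‖logisticMap R z‖ := by
  have h1 : ‖z ^ 2‖ ≤ ‖logisticMap R z‖ + ‖R‖ := by
    have : z ^ 2 = R - logisticMap R z := by simp [logisticMap]
    rw [this, add_comm]
    exact norm_sub_le _ _
  rw [norm_pow] at h1
  nlinarith

/-- Outside the disc of radius ρ moduli never decrease along orbits, so preimages of all orders of
the disc stay inside it. This bounds all inverse branches uniformly. -/
lemma norm_le_of_norm_iterate_le {R z : ℂ} {ρ : ℝ} (hρ : ‖R‖ + 2 ≤ ρ) (j : ℕ)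
    (h : ‖(logisticMap R)^[j] z‖ ≤ ρ) : ‖z‖ ≤ ρ := by
  by_contra! hz
  have hR := norm_nonneg R
  have key : ∀ i, ‖z‖ ≤ ‖(logisticMap R)^[i] z‖ := by
    intro i
    induction i with
    | zero => simp
    | succ i ih =>
      rw [iterate_succ_apply']
      exact ih.trans (norm_le_norm_logisticMap (by linarith) (by linarith))
  linarith [key j]

lemma continuous_logisticMap (R : ℂ) : Continuous (logisticMap R) := by
  unfold logisticMap; fun_prop

/-- The open half plane to the right of the line of real part `M`. -/
def halfPlane (M : ℝ) : Set ℂ := {w | M < w.re}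

lemma isOpen_halfPlane (M : ℝ) : IsOpen (halfPlane M) :=
  isOpen_lt continuous_const Complex.continuous_re

lemma convex_halfPlane (M : ℝ) : Convex ℝ (halfPlane M) := convex_halfSpace_re_gt M

lemma nonempty_halfPlane (M : ℝ) : (halfPlane M).Nonempty := ⟨((M + 1 : ℝ) : ℂ), by simp [halfPlane]⟩

open Set in
/-- If the critical orbit misses the image of `ψ`, then `ψ` lifts through the iterates of the map,
along a given semiconjugacy. -/
lemma exists_lift {R : ℂ} {M : ℝ} {ψ Φ : ℂ → ℂ} (hψ : DifferentiableOn ℂ ψ (halfPlane M))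
    (hΦ : ContinuousOn Φ (halfPlane M)) (hm : MapsTo Φ (halfPlane M) (halfPlane M)) {N : ℕ}
    (hN : ∀ w ∈ halfPlane M, (logisticMap R)^[N] (ψ w) = ψ (Φ w))
    (hcrit : ∀ j, ∀ w ∈ halfPlane M, (logisticMap R)^[j] 0 ≠ ψ w) (j : ℕ) (hj : j ≤ N) :
    ∃ L : ℂ → ℂ, DifferentiableOn ℂ L (halfPlane M) ∧ ∀ w ∈ halfPlane M,
      (logisticMap R)^[j] (L w) = ψ w ∧ L (Φ w) = (logisticMap R)^[N - j] (ψ w) := by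
  induction j with
  | zero => exact ⟨ψ, hψ, fun w hw => ⟨rfl, (hN w hw).symm⟩⟩
  | succ j ih =>
    obtain ⟨L, hL, hL2⟩ := ih (by omega)
    -- A zero would mean f(0) = L w, so that the critical orbit reaches ψ w at time j + 1.
    have hne : ∀ w ∈ halfPlane M, R - L w ≠ 0 := by
      intro w hw h0
      apply hcrit (j + 1) w hw
      rw [iterate_succ_apply, ← (hL2 w hw).1]
      congr 1
      rw [← sub_eq_zero.1 h0]
      simp [logisticMap]
    obtain ⟨h, hh, hsq⟩ := exists_holomorphic_sqrt (convex_halfPlane M) (nonempty_halfPlane M)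
      (isOpen_halfPlane M) ((differentiableOn_const R).sub hL) hne
    have hNj : N - j = (N - (j + 1)) + 1 := by omega
    have hsq2 : ∀ w ∈ halfPlane M,
        h (Φ w) ^ 2 = ((logisticMap R)^[N - (j + 1)] (ψ w)) ^ 2 := by
      intro w hw
      rw [hsq]
      simp only [Pi.sub_apply, (hL2 w hw).2, hNj, iterate_succ_apply']
      simp [logisticMap]
    have hcont : ContinuousOn (fun w => (logisticMap R)^[N - (j + 1)] (ψ w)) (halfPlane M) :=
      ((continuous_logisticMap R).iterate _).comp_continuousOn hψ.continuousOn
    have hcont2 : ContinuousOn (fun w => h (Φ w)) (halfPlane M) := hh.continuousOn.comp hΦ hm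
    have hne2 : ∀ {w : ℂ}, w ∈ halfPlane M → (logisticMap R)^[N - (j + 1)] (ψ w) ≠ 0 := by
      intro w hw h0
      have := hsq2 w hw
      rw [hsq, h0] at this
      exact hne _ (hm hw) (by simpa using this)
    have hlift : ∀ w ∈ halfPlane M, (logisticMap R) (h w) = L w := by
      intro w _
      simp [logisticMap, hsq]
    -- Both functions are continuous nonvanishing roots of the same function on a connected set, so
    -- one global sign relates them; it is absorbed into the choice of h.
    rcases (convex_halfPlane M).isPreconnected.eq_or_eq_neg_of_sq_eq hcont2 hcont
        (fun w hw => hsq2 w hw) hne2 with he | he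
    · refine ⟨h, hh, fun w hw => ⟨?_, he hw⟩⟩
      rw [iterate_succ_apply, hlift w hw, (hL2 w hw).1]
    · refine ⟨fun w => -h w, hh.neg, fun w hw => ⟨?_, ?_⟩⟩
      · rw [iterate_succ_apply]
        have : logisticMap R (-h w) = L w := by rw [← hlift w hw]; simp [logisticMap]
        rw [this, (hL2 w hw).1]
      · have := he hw
        simp only [Pi.neg_apply] at this
        change -h (Φ w) = _
        rw [this, neg_neg]

open Set in
/-- The critical orbit enters every invariant half plane on which the iterate acts nearly as a
translation by one. -/
lemma exists_critical_mem {R : ℂ} {M ρ : ℝ} {n : ℕ} {ψ F : ℂ → ℂ}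
    (hψ : DifferentiableOn ℂ ψ (halfPlane M)) (hb : ∀ w ∈ halfPlane M, ‖ψ w‖ ≤ ρ)
    (hinj : InjOn ψ (halfPlane M))
    (hF : ContinuousOn F (halfPlane M)) (hF1 : ∀ w ∈ halfPlane M, ‖F w - w - 1‖ ≤ 1 / 2)
    (hconj : ∀ w ∈ halfPlane M, (logisticMap R)^[n] (ψ w) = ψ (F w)) :
    ∃ j, ∃ w ∈ halfPlane M, (logisticMap R)^[j] 0 = ψ w := by
  by_contra! hcrit
  wlog hρ : ‖R‖ + 2 ≤ ρ generalizing ρ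
  · exact this (ρ := max ρ (‖R‖ + 2)) (fun w hw => (hb w hw).trans (le_max_left _ _))
      (le_max_right _ _)
  have hρ0 : 0 ≤ ρ := by have := norm_nonneg R; linarith
  have hre : ∀ w ∈ halfPlane M, w.re + 1 / 2 ≤ (F w).re := by
    intro w hw
    have h1 := (Complex.abs_re_le_norm (F w - w - 1)).trans (hF1 w hw)
    rw [abs_le] at h1
    simp at h1
    linarith [h1.1]
  have hm : MapsTo F (halfPlane M) (halfPlane M) := by
    intro w hw
    have h1 := hre w hw
    have h2 : M < w.re := hw
    change M < _
    linarith
  have hmi : ∀ m, MapsTo F^[m] (halfPlane M) (halfPlane M) := fun m => hm.iterate m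
  have hrei : ∀ m : ℕ, ∀ w ∈ halfPlane M, w.re + m / 2 ≤ (F^[m] w).re := by
    intro m w hw
    induction m with
    | zero => simp
    | succ m ih =>
      rw [iterate_succ_apply']
      have := hre _ (hmi m hw)
      push_cast
      linarith
  have hci : ∀ m, ContinuousOn F^[m] (halfPlane M) := fun m => hF.iterate hm m
  have hconji : ∀ m, ∀ w ∈ halfPlane M, (logisticMap R)^[n * m] (ψ w) = ψ (F^[m] w) := by
    intro m
    induction m with
    | zero => intro w _; simp
    | succ m ih =>
      intro w hw
      rw [Nat.mul_succ, iterate_add_apply, hconj w hw, ih _ (hm hw), iterate_succ_apply]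
  obtain ⟨w₀, hw₀⟩ := nonempty_halfPlane M
  -- The inverse branch L of f^(nm) is bounded by ρ and sends F^m(F w₀), F^m(w₀) to ψ(F w₀), ψ(w₀).
  -- These two arguments are at distance at most 3/2, and the half plane contains the disc of radius
  -- m/2 about the second. The Schwarz lemma then gives a bound that tends to 0, against the
  -- injectivity of ψ. For m ≥ 4 the radius exceeds 3/2.
  have hbound : ∀ m : ℕ, 4 ≤ m → ‖ψ (F w₀) - ψ w₀‖ ≤ 6 * ρ / m := by
    intro m hm4
    have hm4' : (4 : ℝ) ≤ m := by exact_mod_cast hm4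
    obtain ⟨L, hL, hL2⟩ := exists_lift hψ (hci m) (hmi m) (hconji m) hcrit (n * m) le_rfl
    have hLb : ∀ w ∈ halfPlane M, ‖L w‖ ≤ ρ := fun w hw =>
      norm_le_of_norm_iterate_le hρ (n * m) (by rw [(hL2 w hw).1]; exact hb w hw)
    have hsub : Metric.ball (F^[m] w₀) (m / 2) ⊆ halfPlane M := by
      intro w hw
      have h1 := hrei m w₀ hw₀
      rw [Metric.mem_ball, dist_eq_norm] at hw
      have h2 := (Complex.abs_re_le_norm (w - F^[m] w₀)).trans_lt hw
      rw [abs_lt, Complex.sub_re] at h2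
      have h3 : M < w₀.re := hw₀
      change M < _
      linarith [h2.1]
    have hd : dist (F^[m] (F w₀)) (F^[m] w₀) ≤ 3 / 2 := by
      rw [← iterate_succ_apply, iterate_succ_apply', dist_eq_norm]
      have h1 := hF1 _ (hmi m hw₀)
      calc _ = ‖(F (F^[m] w₀) - F^[m] w₀ - 1) + 1‖ := by ring_nf
        _ ≤ _ := norm_add_le _ _
        _ ≤ 3 / 2 := by rw [norm_one]; linarith
    have hsch := Complex.dist_le_div_mul_dist_of_mapsTo_ball (f := L) (R₂ := 2 * ρ) (hL.mono hsub)
      (by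
        intro w hw
        rw [Metric.mem_closedBall, dist_eq_norm]
        have h1 := hLb w (hsub hw)
        have h2 := hLb _ (hmi m hw₀)
        exact (norm_sub_le _ _).trans (by linarith))
      (z := F^[m] (F w₀)) (by rw [Metric.mem_ball]; linarith)
    rw [(hL2 _ (hm hw₀)).2, (hL2 _ hw₀).2, Nat.sub_self, iterate_zero, id, id, dist_eq_norm] at hsch
    refine hsch.trans ?_
    calc 2 * ρ / (m / 2) * dist (F^[m] (F w₀)) (F^[m] w₀) ≤ 2 * ρ / (m / 2) * (3 / 2) := by
          gcongr
      _ = 6 * ρ / m := by ring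
  have hzero : ‖ψ (F w₀) - ψ w₀‖ ≤ 0 :=
    ge_of_tendsto (tendsto_const_div_atTop_nhds_zero_nat (6 * ρ))
      (Filter.eventually_atTop.2 ⟨4, hbound⟩)
  have heq : F w₀ = w₀ := hinj (hm hw₀) hw₀ (by
    rw [← sub_eq_zero]; exact norm_le_zero_iff.1 hzero)
  have := hre _ hw₀
  rw [heq] at this
  linarith

/-! ### Parabolic petals and their number -/

/-- The branch with leading coefficient `ζ` of the inverse of a Fatou coordinate at `x`, of the
shape `w ↦ x + ζ * w ^ (-1 / k)`. -/
def petalParam (x ζ : ℂ) (k : ℕ) (w : ℂ) : ℂ := x + ζ * Complex.exp (-Complex.log w / k)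

lemma exp_log_div_pow {k : ℕ} (hk : k ≠ 0) {w : ℂ} (hw : w ≠ 0) :
    Complex.exp (-Complex.log w / k) ^ k = w⁻¹ := by
  rw [← Complex.exp_nat_mul, mul_div_cancel₀ _ (by exact_mod_cast hk), Complex.exp_neg,
    Complex.exp_log hw]

lemma petalParam_sub_pow {x ζ : ℂ} {k : ℕ} (hk : k ≠ 0) {w : ℂ} (hw : w ≠ 0) :
    (petalParam x ζ k w - x) ^ k = ζ ^ k * w⁻¹ := by
  rw [petalParam, add_sub_cancel_left, mul_pow, exp_log_div_pow hk hw]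

/-- The k-th power of the distance vector to x recovers w, since ζ and ζ' share their k-th power;
then the exponential cancels. This gives both injectivity on one petal and disjointness of petals in
different directions. -/
lemma petalParam_inj {x ζ ζ' : ℂ} {k : ℕ} (hk : k ≠ 0) (hζ : ζ ≠ 0) (hζζ' : ζ ^ k = ζ' ^ k)
    {w w' : ℂ} (hw : w ≠ 0) (hw' : w' ≠ 0) (h : petalParam x ζ k w = petalParam x ζ' k w') :
    w = w' ∧ ζ = ζ' := by
  have h1 : w = w' := by
    have := congrArg (fun z => (z - x) ^ k) h
    simp only [petalParam_sub_pow hk hw, petalParam_sub_pow hk hw', ← hζζ'] at this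
    exact inv_injective (mul_left_cancel₀ (pow_ne_zero _ hζ) this)
  refine ⟨h1, ?_⟩
  rw [h1] at h
  exact mul_right_cancel₀ (Complex.exp_ne_zero _) (add_left_cancel h)

lemma ne_zero_of_mem_halfPlane {M : ℝ} (hM : 0 ≤ M) {w : ℂ} (hw : w ∈ halfPlane M) : w ≠ 0 := by
  rintro rfl
  exact absurd hw (by simpa [halfPlane] using hM)

lemma mem_slitPlane_of_mem_halfPlane {M : ℝ} (hM : 0 ≤ M) {w : ℂ} (hw : w ∈ halfPlane M) :
    w ∈ Complex.slitPlane := Or.inl (hM.trans_lt hw)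

lemma differentiableOn_petalParam (x ζ : ℂ) (k : ℕ) {M : ℝ} (hM : 0 ≤ M) :
    DifferentiableOn ℂ (petalParam x ζ k) (halfPlane M) := by
  intro w hw
  have := mem_slitPlane_of_mem_halfPlane hM hw
  refine DifferentiableAt.differentiableWithinAt ?_
  unfold petalParam
  refine ((((Complex.differentiableAt_log this).neg).div_const _).cexp.const_mul _).const_add _

section Petals

open Filter Topology

/-- The filter `comap Complex.re atTop` encodes "on a half plane far enough to the right"; it turns
the asymptotics of a petal into limits. -/
lemma tendsto_inv_comap_re : Tendsto (fun w : ℂ => w⁻¹) (comap Complex.re atTop) (𝓝 0) := by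
  refine tendsto_inv₀_cobounded.comp ?_
  rw [← tendsto_norm_atTop_iff_cobounded]
  exact tendsto_atTop_mono (fun w => Complex.re_le_norm w) tendsto_comap

lemma eventually_ne_zero_comap_re : ∀ᶠ w in comap Complex.re atTop, w ≠ 0 ∧ 0 < w.re := by
  filter_upwards [tendsto_comap.eventually (eventually_gt_atTop (0 : ℝ))] with w hw
  exact ⟨by rintro rfl; simp at hw, hw⟩

lemma tendsto_petalParam (x ζ : ℂ) {k : ℕ} (hk : k ≠ 0) :
    Tendsto (petalParam x ζ k) (comap Complex.re atTop) (𝓝 x) := by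
  have h1 : Tendsto (fun w => Complex.exp (-Complex.log w / k)) (comap Complex.re atTop) (𝓝 0) := by
    rw [tendsto_zero_iff_norm_tendsto_zero]
    have h2 : Tendsto (fun w : ℂ => ‖w⁻¹‖ ^ ((k : ℝ)⁻¹)) (comap Complex.re atTop) (𝓝 0) := by
      have := (tendsto_inv_comap_re.norm).rpow_const (p := (k : ℝ)⁻¹) (Or.inr (by positivity))
      rwa [norm_zero, Real.zero_rpow (by positivity)] at this
    refine h2.congr' ?_
    filter_upwards [eventually_ne_zero_comap_re] with w hw
    rw [← exp_log_div_pow hk hw.1, norm_pow, Real.pow_rpow_inv_natCast (norm_nonneg _) hk]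
  have := (h1.const_mul ζ).const_add x
  rw [mul_zero, add_zero] at this
  exact this

/-- The **Leau petals**: near a fixed point with multiplier one of the iterate, the latter is
conjugate, in the coordinate `w`, to a map close to the translation by one. -/
lemma exists_petal {g q : ℂ → ℂ} {x ζ : ℂ} {k : ℕ} (hk : k ≠ 0) (hq : Continuous q)
    (hqx : q x ≠ 0) (hg : ∀ z, g z = z + (z - x) ^ (k + 1) * q z)
    (hζ : ζ ^ k = -(k * q x)⁻¹) {U : Set ℂ} (hU : U ∈ 𝓝 x) :
    ∃ M : ℝ, 0 ≤ M ∧ ∃ F : ℂ → ℂ, ContinuousOn F (halfPlane M) ∧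
      ∀ w ∈ halfPlane M, petalParam x ζ k w ∈ U ∧ ‖F w - w - 1‖ ≤ 1 / 2 ∧
        g (petalParam x ζ k w) = petalParam x ζ k (F w) := by
  set ψ := petalParam x ζ k with hψ
  -- Here g(ψ w) - x = (ψ w - x)(1 - s w). As w is proportional to (ψ w - x)^(-k), the map in the
  -- coordinate w must be w(1 - s w)^(-k), and s w ~ 1/(k w) makes this w + 1 + o(1).
  set s : ℂ → ℂ := fun w => q (ψ w) / (k * q x) * w⁻¹ with hs
  have hk' : (k : ℂ) ≠ 0 := by exact_mod_cast hk
  set F : ℂ → ℂ := fun w => w * ((1 - s w) ^ k)⁻¹ with hF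
  have hψt : Tendsto ψ (comap Complex.re atTop) (𝓝 x) := tendsto_petalParam x ζ hk
  have hqt : Tendsto (fun w => q (ψ w) / (k * q x)) (comap Complex.re atTop) (𝓝 (k : ℂ)⁻¹) := by
    have := ((hq.tendsto x).comp hψt).div_const (k * q x)
    rwa [div_mul_cancel_right₀ hqx] at this
  have hst : Tendsto s (comap Complex.re atTop) (𝓝 0) := by
    have := hqt.mul tendsto_inv_comap_re
    rwa [mul_zero] at this
  set G : ℂ → ℂ := fun t => ((1 - t) ^ k)⁻¹ with hG
  have hGd : HasDerivAt G k 0 := by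
    have h1 : HasDerivAt (fun t : ℂ => 1 - t) (-1) 0 := by
      simpa using (hasDerivAt_id (0 : ℂ)).const_sub 1
    have h2 := (h1.fun_pow k).fun_inv (by simp)
    simpa [hG] using h2
  have hDt : Tendsto (fun w => dslope G 0 (s w)) (comap Complex.re atTop) (𝓝 (k : ℂ)) := by
    have h1 := continuousAt_dslope_same.2 hGd.differentiableAt
    have h2 := h1.tendsto.comp hst
    rwa [dslope_same, hGd.deriv] at h2
  have hFt : Tendsto (fun w => F w - w) (comap Complex.re atTop) (𝓝 1) := by
    have h1 := hqt.mul hDt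
    rw [inv_mul_cancel₀ hk'] at h1
    refine h1.congr' ?_
    filter_upwards [eventually_ne_zero_comap_re] with w hw
    have h2 : s w * dslope G 0 (s w) = G (s w) - G 0 := by
      have := sub_smul_dslope G 0 (s w)
      simpa using this
    have h3 : w * s w = q (ψ w) / (k * q x) := by
      rw [hs]
      have := hw.1
      field_simp
    rw [← h3, mul_assoc, h2]
    simp only [hG, hF]
    simp
    ring
  have hlog : Tendsto (fun w => Complex.log (1 - s w)) (comap Complex.re atTop) (𝓝 0) := by
    have h1 : ContinuousAt Complex.log 1 := continuousAt_clog (by simp)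
    have h2 : Tendsto (fun w => 1 - s w) (comap Complex.re atTop) (𝓝 1) := by
      simpa using hst.const_sub 1
    have h3 := h1.tendsto.comp h2
    rwa [Complex.log_one] at h3
  -- With |Im log w| < π/2 and a correction below 1 < π/2, the logarithm of F w stays in the
  -- principal strip, so the same branch of the k-th root applies to F w.
  have hlogk : ∀ᶠ w in comap Complex.re atTop, ‖(k : ℂ) * Complex.log (1 - s w)‖ < 1 := by
    have h1 := (hlog.const_mul (k : ℂ)).norm
    rw [mul_zero, norm_zero] at h1
    exact h1.eventually_lt_const one_pos
  have hev : ∀ᶠ w in comap Complex.re atTop, ψ w ∈ U ∧ ‖F w - w - 1‖ ≤ 1 / 2 ∧ 1 - s w ≠ 0 ∧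
      ‖(k : ℂ) * Complex.log (1 - s w)‖ < 1 ∧ 0 < w.re := by
    have h1 : ∀ᶠ w in comap Complex.re atTop, ‖F w - w - 1‖ ≤ 1 / 2 := by
      have := (hFt.sub_const 1).norm
      rw [sub_self, norm_zero] at this
      exact (this.eventually_lt_const (by norm_num : (0 : ℝ) < 1 / 2)).mono fun _ h => h.le
    have h2 : ∀ᶠ w in comap Complex.re atTop, 1 - s w ≠ 0 := by
      have := hst.const_sub 1
      rw [sub_zero] at this
      exact this.eventually_ne one_ne_zero
    filter_upwards [hψt.eventually_mem hU, h1, h2, hlogk, eventually_ne_zero_comap_re]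
      with w a b c d e using ⟨a, b, c, d, e.2⟩
  rw [eventually_comap] at hev
  obtain ⟨M₀, hM₀⟩ := eventually_atTop.1 hev
  have hall : ∀ w ∈ halfPlane (max M₀ 0), _ := fun w hw =>
    hM₀ w.re ((le_max_left _ _).trans (le_of_lt hw)) w rfl
  have hM : (0 : ℝ) ≤ max M₀ 0 := le_max_right _ _
  refine ⟨max M₀ 0, hM, F, ?_, fun w hw => ⟨(hall w hw).1, (hall w hw).2.1, ?_⟩⟩
  · have hψc := (differentiableOn_petalParam x ζ k hM).continuousOn
    have hsc : ContinuousOn s (halfPlane (max M₀ 0)) :=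
      ((hq.comp_continuousOn hψc).div_const _).mul
        (continuousOn_id.inv₀ fun w hw => ne_zero_of_mem_halfPlane hM hw)
    exact continuousOn_id.mul (((continuousOn_const.sub hsc).pow k).inv₀ fun w hw =>
      pow_ne_zero _ (hall w hw).2.2.1)
  · obtain ⟨-, -, h1, h2, h3⟩ := hall w hw
    have hw0 : w ≠ 0 := ne_zero_of_mem_halfPlane hM hw
    have hFw : F w = Complex.exp (Complex.log w - k * Complex.log (1 - s w)) := by
      rw [Complex.exp_sub, Complex.exp_log hw0, Complex.exp_nat_mul, Complex.exp_log h1, hF,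
        div_eq_mul_inv]
    have him : |(Complex.log w - k * Complex.log (1 - s w)).im| < Real.pi := by
      have h4 : |(Complex.log w).im| < Real.pi / 2 := by
        rw [Complex.log_im]
        exact Complex.abs_arg_lt_pi_div_two_iff.2 (Or.inl h3)
      have h5 := (Complex.abs_im_le_norm _).trans_lt h2
      rw [Complex.sub_im]
      have h6 := Real.pi_gt_three
      calc _ ≤ _ := abs_sub _ _
        _ < Real.pi := by linarith
    rw [abs_lt] at him
    have hlogF : Complex.log (F w) = Complex.log w - k * Complex.log (1 - s w) := by
      rw [hFw, Complex.log_exp him.1 him.2.le]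
    have h7 : ψ (F w) = x + (ψ w - x) * (1 - s w) := by
      rw [hψ, petalParam, hlogF, petalParam, add_sub_cancel_left, mul_assoc]
      congr 2
      rw [← Complex.exp_log h1, ← Complex.exp_add, Complex.exp_log h1]
      congr 1
      field_simp
      ring
    have h8 : (ψ w - x) ^ k * q (ψ w) = - s w := by
      rw [hψ, petalParam_sub_pow hk hw0, hζ, ← hψ, hs]
      field_simp
    rw [hg, h7, pow_succ, mul_right_comm, h8]
    ring

/-- The polynomial `x - f^n(x)` for the parameter `R`. -/
def periodPoly (n : ℕ) (R : ℂ) : ℂ[X] := (X - iterPoly n).map (evalRingHom R)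

lemma eval_iterPoly_map (n : ℕ) (R z : ℂ) :
    ((iterPoly n).map (evalRingHom R)).eval z = (logisticMap R)^[n] z := by
  induction n with
  | zero => simp [iterPoly]
  | succ k ih =>
    rw [iterPoly_succ, iterate_succ_apply', ← ih]
    simp [logisticMap]

lemma eval_periodPoly (n : ℕ) (R z : ℂ) :
    (periodPoly n R).eval z = z - (logisticMap R)^[n] z := by
  rw [periodPoly, Polynomial.map_sub, eval_sub, eval_iterPoly_map]
  simp

lemma periodPoly_ne_zero {n : ℕ} (hn : 0 < n) (R : ℂ) : periodPoly n R ≠ 0 := by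
  obtain ⟨m, rfl⟩ : ∃ m, n = m + 1 := ⟨n - 1, by omega⟩
  exact ((iterPoly_monic m).map _).ne_zero

open Set in
/-- Disjoint attracting petals at a fixed point of the iterate, as many as its multiplicity minus
one; each of them meets the critical orbit. -/
lemma exists_petals {n : ℕ} (hn : 0 < n) (R x : ℂ) {U : Set ℂ} (hU : U ∈ nhds x) :
    ∃ (Z : Finset ℂ) (S : ℂ → Set ℂ), Z.card = (periodPoly n R).rootMultiplicity x - 1 ∧
      (∀ ζ ∈ Z, S ζ ⊆ U ∧ MapsTo (logisticMap R)^[n] (S ζ) (S ζ) ∧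
        ∃ j, (logisticMap R)^[j] 0 ∈ S ζ) ∧
      ∀ ζ ∈ Z, ∀ ζ' ∈ Z, ∀ z ∈ S ζ, z ∈ S ζ' → ζ = ζ' := by
  obtain ⟨Q, hQ, hQx⟩ := exists_eq_pow_rootMultiplicity_mul_and_not_dvd (periodPoly n R)
    (periodPoly_ne_zero hn R) x
  rw [dvd_iff_isRoot, IsRoot.def] at hQx
  set k := (periodPoly n R).rootMultiplicity x - 1 with hkdef
  rcases Nat.eq_zero_or_pos k with hk | hk
  · exact ⟨∅, fun _ => ∅, by simp [hk], by simp, by simp⟩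
  have hmul : (periodPoly n R).rootMultiplicity x = k + 1 := by omega
  have hk' : (k : ℂ) ≠ 0 := by exact_mod_cast hk.ne'
  rw [hmul] at hQ
  have hg : ∀ z, (logisticMap R)^[n] z = z + (z - x) ^ (k + 1) * (-Q).eval z := by
    intro z
    have := eval_periodPoly n R z
    rw [hQ] at this
    simp at this
    simp
    linear_combination this
  have hqx : (-Q).eval x ≠ 0 := by simpa using hQx
  -- The k-th roots of b are the attracting directions. The sign of Q comes from `periodPoly` being
  -- x - f^n rather than f^n - x.
  set b : ℂ := -(k * (-Q).eval x)⁻¹ with hb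
  have hb0 : b ≠ 0 := neg_ne_zero.2 (inv_ne_zero (mul_ne_zero hk' hqx))
  have hζ0 : ∀ ζ ∈ (nthRoots k b).toFinset, ζ ^ k = b := by
    intro ζ hζ
    rwa [Multiset.mem_toFinset, mem_nthRoots hk] at hζ
  -- The unit ball keeps the petals bounded, as `exists_critical_mem` requires.
  have hU' : U ∩ Metric.ball x 1 ∈ nhds x := Filter.inter_mem hU (Metric.ball_mem_nhds x one_pos)
  have hp : ∀ ζ ∈ (nthRoots k b).toFinset, _ := fun ζ hζ =>
    exists_petal hk.ne' (-Q).continuous hqx hg (hζ0 ζ hζ) hU'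
  choose! M hM F hF hall using hp
  refine ⟨(nthRoots k b).toFinset, fun ζ => petalParam x ζ k '' halfPlane (M ζ), ?_, ?_, ?_⟩
  · have hsep : (X ^ k - C b).Separable := separable_X_pow_sub_C b hk' hb0
    rw [nthRoots, Multiset.toFinset_card_of_nodup (nodup_roots hsep),
      ← (IsAlgClosed.splits (X ^ k - C b)).natDegree_eq_card_roots, natDegree_X_pow_sub_C]
  · intro ζ hζ
    have hre : ∀ w ∈ halfPlane (M ζ), F ζ w ∈ halfPlane (M ζ) := by
      intro w hw
      have h1 := (Complex.abs_re_le_norm (F ζ w - w - 1)).trans (hall ζ hζ w hw).2.1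
      rw [abs_le] at h1
      simp at h1
      have h2 : M ζ < w.re := hw
      change M ζ < _
      linarith [h1.1]
    refine ⟨?_, ?_, ?_⟩
    · rintro _ ⟨w, hw, rfl⟩
      exact (hall ζ hζ w hw).1.1
    · rintro _ ⟨w, hw, rfl⟩
      rw [(hall ζ hζ w hw).2.2]
      exact ⟨_, hre w hw, rfl⟩
    · have hζne : ζ ≠ 0 := by
        rintro rfl
        have := hζ0 0 hζ
        rw [zero_pow hk.ne'] at this
        exact hb0 this.symm
      obtain ⟨j, w, hw, hj⟩ := exists_critical_mem (R := R) (n := n) (ρ := ‖x‖ + 1)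
        (differentiableOn_petalParam x ζ k (hM ζ hζ)) (fun w hw => by
          have h1 := (hall ζ hζ w hw).1.2
          rw [Metric.mem_ball, dist_eq_norm] at h1
          have h2 := norm_sub_norm_le (petalParam x ζ k w) x
          linarith)
        (fun w hw w' hw' h => (petalParam_inj hk.ne' hζne rfl
          (ne_zero_of_mem_halfPlane (hM ζ hζ) hw) (ne_zero_of_mem_halfPlane (hM ζ hζ) hw') h).1)
        (hF ζ hζ) (fun w hw => (hall ζ hζ w hw).2.1) (fun w hw => (hall ζ hζ w hw).2.2)
      exact ⟨j, w, hw, hj.symm⟩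
  · rintro ζ hζ ζ' hζ' _ ⟨w, hw, rfl⟩ ⟨w', hw', h⟩
    have hζne : ζ ≠ 0 := by
      rintro rfl
      have := hζ0 0 hζ
      rw [zero_pow hk.ne'] at this
      exact hb0 this.symm
    exact (petalParam_inj hk.ne' hζne ((hζ0 ζ hζ).trans (hζ0 ζ' hζ').symm)
          (ne_zero_of_mem_halfPlane (hM ζ hζ) hw) (ne_zero_of_mem_halfPlane (hM ζ' hζ') hw')
          h.symm).2

/-- The total number of petals at the fixed points of the `n`-th iterate is at most `n`, since
there is just one critical orbit. -/
theorem sum_rootMultiplicity_sub_one_le {n : ℕ} (hn : 0 < n) (R : ℂ) (T : Finset ℂ) :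
    ∑ x ∈ T, ((periodPoly n R).rootMultiplicity x - 1) ≤ n := by
  classical
  obtain ⟨U, hU, hdisj⟩ := T.finite_toSet.t2_separation
  choose Z S hZ hS hinj using fun x => exists_petals hn R x ((hU x).2.mem_nhds (hU x).1)
  simp only [← hZ]
  rw [← Finset.card_sigma]
  choose! j hj using fun x ζ hζ => (hS x ζ hζ).2.2
  rw [← Finset.card_range n]
  -- Each petal is labelled by the residue mod n of a time at which the critical orbit is in it.
  -- Petals are invariant under f^n, so equal labels force a common point of the critical orbit.
  refine Finset.card_le_card_of_injOn (fun p => j p.1 p.2 % n)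
    (fun p _ => by simpa using Nat.mod_lt _ hn) ?_
  rintro ⟨x, ζ⟩ hx ⟨x', ζ'⟩ hx' hmod
  simp only [Finset.coe_sigma, Set.mem_sigma_iff, Finset.mem_coe] at hx hx' hmod
  have hit : ∀ y ζ, ζ ∈ Z y → ∀ m, (logisticMap R)^[n * m + j y ζ] 0 ∈ S y ζ := by
    intro y ζ hζ m
    rw [iterate_add_apply, iterate_mul]
    exact (hS y ζ hζ).2.1.iterate m (hj y ζ hζ)
  have h1 := hit x ζ hx.2 (j x' ζ' / n)
  have h2 := hit x' ζ' hx'.2 (j x ζ / n)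
  have heq : n * (j x' ζ' / n) + j x ζ = n * (j x ζ / n) + j x' ζ' := by
    have e1 := Nat.div_add_mod (j x ζ) n
    have e2 := Nat.div_add_mod (j x' ζ') n
    omega
  rw [heq] at h1
  have hxx : x = x' := by
    by_contra hne
    exact Set.disjoint_left.1 (hdisj hx.1 hx'.1 hne) ((hS x ζ hx.2).1 h1) ((hS x' ζ' hx'.2).1 h2)
  subst hxx
  rw [hinj x ζ hx.2 ζ' hx'.2 _ h1 h2]

end Petals

/-! ### Multipliers and difference quotients over a ring -/

section CommRing

variable {A B : Type*} [CommRing A] [CommRing B]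

/-- The derivative of the `n`-th iterate at `a`, as the product of `-2 y` along the orbit. -/
def orbitMul (R : A) (n : ℕ) (a : A) : A := ∏ i ∈ Finset.range n, (-2 * (logisticMap R)^[i] a)

/-- The difference quotient of the `n`-th iterate. -/
def diffQuot (R : A) (n : ℕ) (a b : A) : A :=
  ∏ i ∈ Finset.range n, (-((logisticMap R)^[i] a + (logisticMap R)^[i] b))

lemma map_iterate_logisticMap (φ : A →+* B) (R : A) (i : ℕ) (a : A) :
    φ ((logisticMap R)^[i] a) = (logisticMap (φ R))^[i] (φ a) := by
  have h : Semiconj φ (logisticMap R) (logisticMap (φ R)) := fun y => by simp [logisticMap]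
  exact (h.iterate_right i).eq a

lemma map_orbitMul (φ : A →+* B) (R : A) (n : ℕ) (a : A) :
    φ (orbitMul R n a) = orbitMul (φ R) n (φ a) := by
  simp only [orbitMul, map_prod, map_mul, map_neg, map_ofNat, map_iterate_logisticMap]

/-- This replaces calculus: when two points merge under reduction, their difference quotient reduces
to the multiplier. -/
lemma map_diffQuot (φ : A →+* B) (R : A) (n : ℕ) {a b : A} (h : φ a = φ b) :
    φ (diffQuot R n a b) = orbitMul (φ R) n (φ a) := by
  simp only [diffQuot, orbitMul, map_prod, map_neg, map_add, map_iterate_logisticMap, h]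
  refine Finset.prod_congr rfl fun i _ => by ring

lemma iterate_sub_iterate (R : A) (n : ℕ) (a b : A) :
    (logisticMap R)^[n] a - (logisticMap R)^[n] b = (a - b) * diffQuot R n a b := by
  induction n with
  | zero => simp [diffQuot]
  | succ n ih =>
    rw [diffQuot, Finset.prod_range_succ, ← diffQuot, ← mul_assoc, ← ih, iterate_succ_apply',
      iterate_succ_apply', logisticMap, logisticMap]
    ring

lemma orbitMul_succ (R : A) (n : ℕ) (a : A) :
    orbitMul R (n + 1) a = orbitMul R n a * (-2 * (logisticMap R)^[n] a) := by
  rw [orbitMul, Finset.prod_range_succ, ← orbitMul]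

lemma orbitMul_add (R : A) (m n : ℕ) (a : A) :
    orbitMul R (m + n) a = orbitMul R m a * orbitMul R n ((logisticMap R)^[m] a) := by
  simp only [orbitMul, Finset.prod_range_add]
  congr 1
  refine Finset.prod_congr rfl fun i _ => ?_
  rw [add_comm m i, iterate_add_apply]

lemma orbitMul_mul (R : A) {d : ℕ} {a : A} (h : (logisticMap R)^[d] a = a) (c : ℕ) :
    orbitMul R (d * c) a = orbitMul R d a ^ c := by
  induction c with
  | zero => simp [orbitMul]
  | succ c ih =>
    have : (logisticMap R)^[d * c] a = a := IsPeriodicPt.mul_const h c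
    rw [Nat.mul_succ, orbitMul_add, ih, this, pow_succ]

lemma orbitMul_iterate (R : A) {n : ℕ} {a : A} (h : (logisticMap R)^[n] a = a) (i : ℕ) :
    orbitMul R n ((logisticMap R)^[i] a) = orbitMul R n a := by
  induction i with
  | zero => rfl
  | succ i ih =>
    rw [← ih, iterate_succ_apply']
    set b := (logisticMap R)^[i] a with hb
    have hb' : (logisticMap R)^[n] b = b := by
      rw [hb, ← iterate_add_apply, add_comm, iterate_add_apply, h]
    cases n with
    | zero => simp [orbitMul]
    | succ n =>
      rw [orbitMul_succ, ← iterate_succ_apply, hb', add_comm n 1, orbitMul_add]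
      simp [orbitMul, mul_comm]

lemma eval₂_iterPoly (φ : ℂ[X] →+* A) (n : ℕ) (a : A) :
    (iterPoly n).eval₂ φ a = (logisticMap (φ X))^[n] a := by
  induction n with
  | zero => simp [iterPoly]
  | succ k ih =>
    rw [iterPoly_succ, iterate_succ_apply', ← ih, eval₂_sub, eval₂_C, eval₂_pow, logisticMap]

lemma eval₂_derivative_iterPoly (φ : ℂ[X] →+* A) (n : ℕ) (a : A) :
    (derivative (iterPoly n)).eval₂ φ a = orbitMul (φ X) n a := by
  induction n with
  | zero => simp [iterPoly, orbitMul]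
  | succ k ih =>
    rw [iterPoly_succ, orbitMul_succ, ← ih, ← eval₂_iterPoly φ k a]
    simp only [derivative_sub, derivative_C, zero_sub, derivative_pow, eval₂_neg, eval₂_mul,
      Nat.cast_ofNat, map_ofNat, eval₂_ofNat, Nat.add_one_sub_one, pow_one]
    ring

end CommRing

lemma hasDerivAt_iterate (R : ℂ) (n : ℕ) (x : ℂ) :
    HasDerivAt (logisticMap R)^[n] (orbitMul R n x) x := by
  have h1 := ((iterPoly n).map (evalRingHom R)).hasDerivAt x
  rw [derivative_map, eval_map, eval₂_derivative_iterPoly] at h1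
  simp only [eval_iterPoly_map, coe_evalRingHom, eval_X] at h1
  exact h1

lemma eval_derivative_periodPoly (n : ℕ) (R x : ℂ) :
    (derivative (periodPoly n R)).eval x = 1 - orbitMul R n x := by
  rw [periodPoly, derivative_map, eval_map, derivative_sub, eval₂_sub, eval₂_derivative_iterPoly]
  simp

/-- At the parameter zero no periodic point has a multiplier of modulus one. -/
lemma norm_orbitMul_zero_ne_one {n : ℕ} (hn : 0 < n) {x : ℂ} (hx : (logisticMap 0)^[n] x = x) :
    ‖orbitMul 0 n x‖ ≠ 1 := by
  have key : ∀ i, ‖(logisticMap 0)^[i] x‖ = ‖x‖ ^ 2 ^ i := by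
    intro i
    induction i with
    | zero => simp
    | succ i ih =>
      rw [iterate_succ_apply', logisticMap, zero_sub, norm_neg, norm_pow, ih, pow_succ 2 i, pow_mul]
  have h1 := key n
  rw [hx] at h1
  -- The map -x² squares moduli, so a periodic point is 0 or on the unit circle, and its multiplier
  -- is 0 or has modulus 2^n.
  have h2 : ‖x‖ = 0 ∨ ‖x‖ = 1 := by
    rcases eq_or_ne (‖x‖) 0 with h | h
    · exact Or.inl h
    · right
      have h3 : 1 < 2 ^ n := Nat.one_lt_two_pow hn.ne'
      obtain ⟨m, hm⟩ : ∃ m, 2 ^ n = m + 1 := ⟨2 ^ n - 1, by omega⟩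
      rw [hm, pow_succ] at h1
      have h4 : ‖x‖ ^ m = 1 := by
        field_simp at h1
        exact h1.symm
      exact (pow_eq_one_iff_of_nonneg (norm_nonneg _) (by omega)).1 h4
  rw [orbitMul, norm_prod]
  simp only [norm_mul, norm_neg, key, RCLike.norm_ofNat]
  rcases h2 with h | h
  · rw [h, Finset.prod_eq_zero (Finset.mem_range.2 hn) (by simp)]
    exact zero_ne_one
  · simp only [h, one_pow, mul_one, Finset.prod_const, Finset.card_range]
    exact (one_lt_pow₀ one_lt_two hn.ne').ne'

/-! ### Generic periodic points and specialization of the parameter -/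

/-- The integral closure of `ℂ[R]` in the algebraic closure of `ℂ(R)`. -/
abbrev IntRing : Type := integralClosure ℂ[X] GenericField

/-- The indeterminate parameter as an element of `IntRing`. -/
def intR : IntRing := algebraMap ℂ[X] IntRing X

lemma coe_algebraMap_intRing (p : ℂ[X]) :
    ((algebraMap ℂ[X] IntRing p : IntRing) : GenericField) = algebraMap ℂ[X] GenericField p := rfl

lemma algebraMap_genericField_injective : Injective (algebraMap ℂ[X] GenericField) := by
  rw [IsScalarTower.algebraMap_eq ℂ[X] (RatFunc ℂ) GenericField]
  exact (algebraMap (RatFunc ℂ) GenericField).injective.comp (RatFunc.algebraMap_injective ℂ)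

lemma algebraMap_intRing_injective : Injective (algebraMap ℂ[X] IntRing) := fun _ _ h =>
  algebraMap_genericField_injective (congrArg Subtype.val h)

/-- A specialization of the generic parameter to the value `R₀`: a compatible reduction map on the
integral closure, with a valuation ring that dominates it. -/
structure Specialization (R₀ : ℂ) where
  red : IntRing →+* ℂ
  red_algebraMap : ∀ p : ℂ[X], red (algebraMap ℂ[X] IntRing p) = p.eval R₀
  ring : ValuationSubring GenericField
  val_lt_one : ∀ a : IntRing, red a = 0 → ring.valuation a < 1
  val_eq_one : ∀ a : IntRing, red a ≠ 0 → ring.valuation a = 1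

/-- Lying over provides a maximal ideal above (R - R₀); its residue ring is integral over ℂ, hence
equal to ℂ. -/
lemma exists_red (R₀ : ℂ) :
    ∃ red : IntRing →+* ℂ, ∀ p : ℂ[X], red (algebraMap ℂ[X] IntRing p) = p.eval R₀ := by
  have hmax : (RingHom.ker (evalRingHom R₀)).IsMaximal :=
    RingHom.ker_isMaximal_of_surjective _ fun z => ⟨C z, by simp⟩
  obtain ⟨Q, hQ, hQc⟩ := Ideal.exists_ideal_over_maximal_of_isIntegral (S := IntRing)
    (RingHom.ker (evalRingHom R₀)) (by
      rw [(RingHom.injective_iff_ker_eq_bot _).1 algebraMap_intRing_injective]; exact bot_le)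
  set φ : ℂ →+* IntRing ⧸ Q :=
    ((Ideal.Quotient.mk Q).comp (algebraMap ℂ[X] IntRing)).comp C with hφ
  have hfac : φ.comp (evalRingHom R₀) = (Ideal.Quotient.mk Q).comp (algebraMap ℂ[X] IntRing) := by
    ext p
    · simp [hφ]
    · simp only [hφ, RingHom.comp_apply]
      rw [Ideal.Quotient.eq, ← map_sub, ← Ideal.mem_comap, hQc, RingHom.mem_ker]
      simp
  have hint : φ.IsIntegral := by
    refine RingHom.IsIntegral.tower_top (evalRingHom R₀) φ ?_
    rw [hfac]
    refine RingHom.IsIntegral.trans _ _ ?_ ?_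
    · exact algebraMap_isIntegral_iff.2 inferInstance
    · exact RingHom.isIntegral_of_surjective _ Ideal.Quotient.mk_surjective
  have hbij := IsAlgClosed.ringHom_bijective_of_isIntegral φ hint
  refine ⟨((RingEquiv.ofBijective φ hbij).symm : (IntRing ⧸ Q) →+* ℂ).comp (Ideal.Quotient.mk Q),
    fun p => ?_⟩
  have h1 := RingHom.congr_fun hfac p
  simp only [RingHom.comp_apply, coe_evalRingHom] at h1
  rw [RingHom.comp_apply, ← h1]
  exact (RingEquiv.ofBijective φ hbij).symm_apply_apply _

/-- A valuation ring dominates the kernel of the reduction. If a has nonzero reduction, a constant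
multiple of it is 1 plus an element of valuation below 1, so a is a unit there. -/
lemma exists_specialization (R₀ : ℂ) : Nonempty (Specialization R₀) := by
  obtain ⟨red, hred⟩ := exists_red R₀
  obtain ⟨V, hAV, hIV⟩ := Ideal.image_subset_nonunits_valuationSubring
    (A := (integralClosure ℂ[X] GenericField).toSubring) (RingHom.ker red)
    (RingHom.ker_ne_top red)
  have hlt : ∀ a : IntRing, red a = 0 → V.valuation a < 1 := by
    intro a ha
    exact V.mem_nonunits_iff.1 (hIV ⟨a, ha, rfl⟩)
  have hle : ∀ a : IntRing, V.valuation a ≤ 1 := fun a => (V.valuation_le_one_iff _).2 (hAV a.2)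
  refine ⟨red, hred, V, hlt, fun a ha => ?_⟩
  obtain ⟨b, hb⟩ : ∃ b : IntRing, red (a * b - 1) = 0 :=
    ⟨algebraMap ℂ[X] IntRing (C (red a)⁻¹), by
      rw [map_sub, map_mul, hred, eval_C, mul_inv_cancel₀ ha, map_one, sub_self]⟩
  have h1 := hlt _ hb
  have h2 : V.valuation ((a * b : IntRing) : GenericField) = 1 := by
    have : ((a * b : IntRing) : GenericField) = 1 + ((a * b - 1 : IntRing) : GenericField) := by
      push_cast; ring
    rw [this]
    exact V.valuation.map_one_add_of_lt h1
  push_cast at h2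
  rw [map_mul] at h2
  refine le_antisymm (hle a) ?_
  rw [← h2]
  exact mul_le_of_le_one_right' (hle b)

lemma coe_iterate_intRing (i : ℕ) (a : IntRing) :
    (((logisticMap intR)^[i] a : IntRing) : GenericField) = (logisticMap genericR)^[i] a :=
  map_iterate_logisticMap (algebraMap IntRing GenericField) intR i a

lemma coe_orbitMul (n : ℕ) (a : IntRing) :
    ((orbitMul intR n a : IntRing) : GenericField) = orbitMul genericR n (a : GenericField) :=
  map_orbitMul (algebraMap IntRing GenericField) intR n a

lemma minimalPeriod_coe (a : IntRing) :
    minimalPeriod (logisticMap genericR) (a : GenericField) = minimalPeriod (logisticMap intR) a := by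
  apply minimalPeriod_eq_minimalPeriod_iff.2
  intro m
  rw [IsPeriodicPt, IsPeriodicPt, IsFixedPt, IsFixedPt, ← coe_iterate_intRing]
  exact Subtype.coe_injective.eq_iff

lemma exists_intRing_of_iterate_eq {n : ℕ} (hn : 0 < n) {x : GenericField}
    (hx : (logisticMap genericR)^[n] x = x) : ∃ a : IntRing, (a : GenericField) = x := by
  obtain ⟨m, rfl⟩ : ∃ m, n = m + 1 := ⟨n - 1, by omega⟩
  refine ⟨⟨x, X - iterPoly (m + 1), iterPoly_monic m, ?_⟩, rfl⟩
  rw [← aeval_def, map_sub, iterPoly_aeval, aeval_X, hx, sub_self]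

/-- Generic multipliers are not of the form `z` with `|z| = 1`. -/
lemma orbitMul_intR_ne {n : ℕ} (hn : 0 < n) {a : IntRing} (ha : (logisticMap intR)^[n] a = a)
    {z : ℂ} (hz : ‖z‖ = 1) : orbitMul intR n a ≠ algebraMap ℂ[X] IntRing (C z) := by
  intro h
  -- An identity of generic elements survives specialization at R = 0, where it contradicts
  -- `norm_orbitMul_zero_ne_one`.
  obtain ⟨red, hred⟩ := exists_red 0
  have hR : red intR = 0 := by rw [intR, hred, eval_X]
  have h1 := congrArg red h
  rw [map_orbitMul, hR, hred, eval_C] at h1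
  have h2 := congrArg red ha
  rw [map_iterate_logisticMap, hR] at h2
  apply norm_orbitMul_zero_ne_one hn h2
  rw [h1, hz]

/-- The polynomial `x - f^n(x)` for the generic parameter. -/
def genericPeriodPoly (n : ℕ) : IntRing[X] := (X - iterPoly n).map (algebraMap ℂ[X] IntRing)

lemma genericPeriodPoly_monic {n : ℕ} (hn : 0 < n) : (genericPeriodPoly n).Monic := by
  obtain ⟨m, rfl⟩ : ∃ m, n = m + 1 := ⟨n - 1, by omega⟩
  exact (iterPoly_monic m).map _

lemma eval_genericPeriodPoly (n : ℕ) (a : IntRing) :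
    (genericPeriodPoly n).eval a = a - (logisticMap intR)^[n] a := by
  rw [genericPeriodPoly, eval_map, eval₂_sub, eval₂_X, eval₂_iterPoly, intR]

lemma eval_derivative_genericPeriodPoly (n : ℕ) (a : IntRing) :
    (derivative (genericPeriodPoly n)).eval a = 1 - orbitMul intR n a := by
  rw [genericPeriodPoly, derivative_map, eval_map, derivative_sub, eval₂_sub,
    eval₂_derivative_iterPoly, intR, derivative_X, eval₂_one]

open Classical in
/-- The fixed points of the `n`-th iterate for the generic parameter. -/
def fixedPts (n : ℕ) : Finset IntRing :=
  (genericPeriodPoly n).roots.toFinset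

lemma mem_fixedPts {n : ℕ} (hn : 0 < n) {a : IntRing} :
    a ∈ fixedPts n ↔ (logisticMap intR)^[n] a = a := by
  classical
  rw [fixedPts, Multiset.mem_toFinset, mem_roots (genericPeriodPoly_monic hn).ne_zero, IsRoot.def,
    eval_genericPeriodPoly, sub_eq_zero, eq_comm]

/-- A multiple root would be a generic periodic point with multiplier 1, which `orbitMul_intR_ne`
excludes; all roots are integral over ℂ[R]. -/
lemma genericPeriodPoly_eq_prod {n : ℕ} (hn : 0 < n) :
    genericPeriodPoly n = ∏ q ∈ fixedPts n, (X - C q) := by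
  classical
  have hinj : Injective (algebraMap IntRing GenericField) := Subtype.coe_injective
  apply map_injective _ hinj
  set p := (genericPeriodPoly n).map (algebraMap IntRing GenericField) with hp
  have hmonic : p.Monic := (genericPeriodPoly_monic hn).map _
  have hroot : ∀ r, p.IsRoot r → ∃ a ∈ fixedPts n, algebraMap IntRing GenericField a = r := by
    intro r hr
    have h1 : (logisticMap genericR)^[n] r = r := by
      rw [IsRoot.def, hp, genericPeriodPoly, map_map, eval_map, eval₂_sub, eval₂_X,
        eval₂_iterPoly, sub_eq_zero] at hr
      exact hr.symm
    obtain ⟨a, rfl⟩ := exists_intRing_of_iterate_eq hn h1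
    refine ⟨a, (mem_fixedPts hn).2 (hinj ?_), rfl⟩
    rw [map_iterate_logisticMap]
    exact h1
  have hnodup : p.roots.Nodup := by
    rw [Multiset.nodup_iff_count_le_one]
    intro r
    rw [count_roots]
    by_contra! h
    rw [one_lt_rootMultiplicity_iff_isRoot hmonic.ne_zero] at h
    obtain ⟨a, ha, rfl⟩ := hroot r h.1
    have h2 := h.2
    rw [IsRoot.def, hp, derivative_map, eval_map_apply, map_eq_zero_iff _ hinj,
      eval_derivative_genericPeriodPoly, sub_eq_zero] at h2
    exact orbitMul_intR_ne hn ((mem_fixedPts hn).1 ha) norm_one (by rw [← h2]; simp)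
  have h1 := (IsAlgClosed.splits p).eq_prod_roots_of_monic hmonic
  have h2 : p.roots = (fixedPts n).val.map (algebraMap IntRing GenericField) := by
    rw [Multiset.Nodup.ext hnodup ((fixedPts n).nodup.map hinj)]
    intro r
    rw [mem_roots hmonic.ne_zero, Multiset.mem_map]
    refine ⟨hroot r, ?_⟩
    rintro ⟨a, ha, rfl⟩
    rw [IsRoot.def, hp, eval_map_apply, eval_genericPeriodPoly, (mem_fixedPts hn).1 ha, sub_self,
      map_zero]
  rw [h1, h2, Multiset.map_map, Polynomial.map_prod, Finset.prod]
  simp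

/-- Both sides are the derivative of x - f^n(x) at its simple root a. The formula converts
multipliers into distances between generic points. -/
lemma one_sub_orbitMul {n : ℕ} (hn : 0 < n) [DecidableEq IntRing] {a : IntRing}
    (ha : (logisticMap intR)^[n] a = a) :
    1 - orbitMul intR n a = ∏ q ∈ (fixedPts n).erase a, (a - q) := by
  rw [← eval_derivative_genericPeriodPoly, genericPeriodPoly_eq_prod hn,
    ← Finset.mul_prod_erase _ _ ((mem_fixedPts hn).2 ha), derivative_mul]
  simp [eval_prod]

/-! ### Collapsing cycles and roots of unity -/

namespace Specialization

variable {R₀ : ℂ} (s : Specialization R₀)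

lemma red_intR : s.red intR = R₀ := by rw [intR, s.red_algebraMap, eval_X]

lemma red_iterate (i : ℕ) (a : IntRing) :
    s.red ((logisticMap intR)^[i] a) = (logisticMap R₀)^[i] (s.red a) := by
  rw [map_iterate_logisticMap, red_intR]

lemma red_orbitMul (n : ℕ) (a : IntRing) :
    s.red (orbitMul intR n a) = orbitMul R₀ n (s.red a) := by
  rw [map_orbitMul, red_intR]

lemma red_diffQuot (n : ℕ) {a b : IntRing} (h : s.red a = s.red b) :
    s.red (diffQuot intR n a b) = orbitMul R₀ n (s.red a) := by
  rw [map_diffQuot _ _ _ h, red_intR]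

lemma periodPoly_eq_prod {n : ℕ} (hn : 0 < n) :
    periodPoly n R₀ = ∏ q ∈ fixedPts n, (X - C (s.red q)) := by
  have h := congrArg (Polynomial.map s.red) (genericPeriodPoly_eq_prod hn)
  rw [Polynomial.map_prod, genericPeriodPoly, map_map] at h
  have hcomp : s.red.comp (algebraMap ℂ[X] IntRing) = evalRingHom R₀ := by
    ext p <;> simp [s.red_algebraMap]
  rw [hcomp] at h
  rw [periodPoly, h]
  simp

/-- Generic fixed points are distinct, so multiplicity at R₀ arises only from their merging. This is
the link between the petal count and the algebra. -/
lemma rootMultiplicity_periodPoly {n : ℕ} (hn : 0 < n) (x : ℂ) :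
    (periodPoly n R₀).rootMultiplicity x = ((fixedPts n).filter fun q => s.red q = x).card := by
  classical
  rw [← count_roots, s.periodPoly_eq_prod hn, roots_prod]
  · simp only [roots_X_sub_C]
    rw [Multiset.count_bind]
    simp only [Multiset.count_singleton, Finset.sum_map_val]
    rw [Finset.card_filter]
    simp only [eq_comm]
  · rw [← s.periodPoly_eq_prod hn]
    exact periodPoly_ne_zero hn R₀

lemma exists_fixedPt {n : ℕ} (hn : 0 < n) {x : ℂ} (hx : (logisticMap R₀)^[n] x = x) :
    ∃ a : IntRing, (logisticMap intR)^[n] a = a ∧ s.red a = x := by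
  have h := eval_periodPoly n R₀ x
  rw [hx, sub_self, s.periodPoly_eq_prod hn, eval_prod, Finset.prod_eq_zero_iff] at h
  obtain ⟨a, ha, h⟩ := h
  refine ⟨a, (mem_fixedPts hn).1 ha, ?_⟩
  rw [eval_sub, eval_X, eval_C, sub_eq_zero] at h
  exact h.symm

/-- For distinct fixed points a, b of f^d the difference quotient is exactly 1, and it reduces to
the multiplier. This plays the role of uniqueness in the implicit function theorem. -/
lemma eq_of_red_eq {d : ℕ} {a b : IntRing} (ha : (logisticMap intR)^[d] a = a)
    (hb : (logisticMap intR)^[d] b = b) (h : s.red a = s.red b)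
    (hne : orbitMul R₀ d (s.red a) ≠ 1) : a = b := by
  by_contra hab
  have h1 := iterate_sub_iterate intR d a b
  rw [ha, hb] at h1
  have h2 : diffQuot intR d a b = 1 := by
    apply mul_left_cancel₀ (sub_ne_zero.2 hab)
    rw [← h1, mul_one]
  apply hne
  rw [← s.red_diffQuot d h, h2, map_one]

lemma minimalPeriod_red_dvd (a : IntRing) :
    minimalPeriod (logisticMap R₀) (s.red a) ∣ minimalPeriod (logisticMap intR) a := by
  apply IsPeriodicPt.minimalPeriod_dvd
  rw [IsPeriodicPt, IsFixedPt, ← s.red_iterate, iterate_minimalPeriod]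

/-- If a generic cycle collapses onto a shorter one, the multiplier of the latter is a primitive
root of unity of order the quotient of the periods. -/
lemma isPrimitiveRoot_of_collapse {n d : ℕ} (hn : 0 < n) {a : IntRing}
    (ha : minimalPeriod (logisticMap intR) a = n)
    (hd : minimalPeriod (logisticMap R₀) (s.red a) = d) (hdn : d < n) :
    IsPrimitiveRoot (orbitMul R₀ d (s.red a)) (n / d) := by
  have hga : (logisticMap intR)^[n] a = a := by rw [← ha]; exact iterate_minimalPeriod
  obtain ⟨c, hc⟩ : d ∣ n := by rw [← ha, ← hd]; exact s.minimalPeriod_red_dvd a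
  have hd0 : 0 < d := Nat.pos_of_ne_zero (by rintro rfl; omega)
  have hc0 : 0 < c := Nat.pos_of_ne_zero (by rintro rfl; omega)
  have hx : (logisticMap R₀)^[d] (s.red a) = s.red a := by rw [← hd]; exact iterate_minimalPeriod
  set μ := orbitMul R₀ d (s.red a) with hμ
  have hne : ∀ e, 0 < e → e < n → (logisticMap intR)^[e] a ≠ a := by
    intro e he hen
    exact not_isPeriodicPt_of_pos_of_lt_minimalPeriod he.ne' (by omega)
  have hredeq : ∀ m, s.red ((logisticMap intR)^[d * m] a) = s.red a := by
    intro m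
    rw [s.red_iterate]
    exact IsPeriodicPt.mul_const hx m
  -- Otherwise a and f^d(a), both fixed by f^n with the same reduction, would coincide.
  have hpow : μ ^ c = 1 := by
    by_contra hcon
    apply hne d hd0 hdn
    have hred := hredeq 1
    rw [mul_one] at hred
    refine s.eq_of_red_eq (d := n) ?_ hga hred ?_
    · rw [← iterate_add_apply, add_comm, iterate_add_apply, hga]
    · rw [hred, hc, orbitMul_mul _ hx]
      exact hcon
  rw [hc, Nat.mul_div_cancel_left _ hd0]
  have hdvd := orderOf_dvd_of_pow_eq_one hpow
  suffices orderOf μ = c by rw [← this]; exact IsPrimitiveRoot.orderOf μ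
  by_contra hlt
  obtain ⟨m, hm⟩ := hdvd
  set o := orderOf μ with ho
  have hm0 : 0 < m := Nat.pos_of_ne_zero (by rintro rfl; omega)
  have ho0 : 0 < o := Nat.pos_of_ne_zero (by intro h; rw [h] at hm; omega)
  have holt : o < c := lt_of_le_of_ne (by rw [hm]; exact Nat.le_mul_of_pos_right _ hm0) hlt
  set b := (logisticMap intR)^[d * o] a with hb
  have hba : b - a ≠ 0 :=
    sub_ne_zero.2 (hne _ (Nat.mul_pos hd0 ho0) (by rw [hc]; exact Nat.mul_lt_mul_of_pos_left holt hd0))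
  -- Were the order o of μ less than c, the steps of the closed orbit of a under f^(do) would sum to
  -- zero. Each is b - a times a difference quotient reducing to 1, so the m quotients would give m
  -- = 0 in ℂ.
  have hsum : (b - a) * ∑ i ∈ Finset.range m, diffQuot intR (d * o * i) b a = 0 := by
    rw [Finset.mul_sum]
    simp only [← iterate_sub_iterate]
    have : ∀ i, (logisticMap intR)^[d * o * i] b = (logisticMap intR)^[d * o * (i + 1)] a := by
      intro i
      rw [hb, ← iterate_add_apply, Nat.mul_succ]
    simp only [this]
    rw [Finset.sum_range_sub fun i => (logisticMap intR)^[d * o * i] a, mul_assoc, ← hm, ← hc, hga]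
    simp
  have h0 := (mul_eq_zero.1 hsum).resolve_left hba
  have h1 := congrArg s.red h0
  rw [map_sum, map_zero] at h1
  have h2 : ∀ i, s.red (diffQuot intR (d * o * i) b a) = 1 := by
    intro i
    rw [s.red_diffQuot _ (hredeq o), hredeq, mul_assoc, orbitMul_mul _ hx, pow_mul, ← hμ,
      pow_orderOf_eq_one, one_pow]
  simp only [h2, Finset.sum_const, Finset.card_range, nsmul_eq_mul, mul_one] at h1
  exact hm0.ne' (by exact_mod_cast h1)

/-- Conversely a generic cycle collapses onto each cycle whose multiplier is a primitive root of
unity other than one. -/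
lemma exists_collapse {d c : ℕ} (hd0 : 0 < d) (hc : 1 < c) {x : ℂ}
    (hd : minimalPeriod (logisticMap R₀) x = d) (hμ : IsPrimitiveRoot (orbitMul R₀ d x) c) :
    ∃ a : IntRing, minimalPeriod (logisticMap intR) a = d * c ∧ s.red a = x := by
  have hn : 0 < d * c := by positivity
  have hx : (logisticMap R₀)^[d] x = x := by rw [← hd]; exact iterate_minimalPeriod
  have h2 : 1 < (periodPoly (d * c) R₀).rootMultiplicity x := by
    rw [one_lt_rootMultiplicity_iff_isRoot (periodPoly_ne_zero hn R₀), IsRoot.def, IsRoot.def,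
      eval_derivative_periodPoly, eval_periodPoly, orbitMul_mul _ hx, hμ.pow_eq_one, sub_self]
    refine ⟨?_, rfl⟩
    rw [sub_eq_zero]
    exact (IsPeriodicPt.mul_const hx c).symm
  rw [s.rootMultiplicity_periodPoly hn, Finset.one_lt_card] at h2
  obtain ⟨a, ha, b, hb, hab⟩ := h2
  by_contra! hno
  -- At least two generic points lie over x. Their periods are multiples of d, and one larger than d
  -- is d times the order of μ, that is d c. If d c never occurs, all are fixed by f^d, and μ ≠ 1
  -- forces them to coincide.
  have key : ∀ q ∈ (fixedPts (d * c)).filter fun q => s.red q = x,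
      (logisticMap intR)^[d] q = q := by
    intro q hq
    rw [Finset.mem_filter, mem_fixedPts hn] at hq
    have hdvd : minimalPeriod (logisticMap intR) q ∣ d * c :=
      IsPeriodicPt.minimalPeriod_dvd hq.1
    have hpos : 0 < minimalPeriod (logisticMap intR) q := Nat.pos_of_dvd_of_pos hdvd hn
    have hdq : d ∣ minimalPeriod (logisticMap intR) q := by
      rw [← hd, ← hq.2]; exact s.minimalPeriod_red_dvd q
    rcases (Nat.le_of_dvd hpos hdq).eq_or_lt with h | h
    · rw [h]; exact iterate_minimalPeriod
    · exfalso
      have h3 := s.isPrimitiveRoot_of_collapse hpos rfl (by rw [hq.2, hd]) h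
      rw [hq.2] at h3
      have h4 := h3.unique hμ
      refine hno q ?_ hq.2
      rw [← h4, Nat.mul_div_cancel' hdq]
  apply hab
  have ha' := (Finset.mem_filter.1 ha).2
  refine s.eq_of_red_eq (key a ha) (key b hb) (ha'.trans (Finset.mem_filter.1 hb).2.symm) ?_
  rw [ha']
  intro h1
  rw [h1] at hμ
  exact hc.ne' (hμ.unique IsPrimitiveRoot.one)

end Specialization

/-! ### Zeros and orders of the cycle polynomials -/

open Classical in
/-- The cycle of a generic periodic point. -/
def orbitSet (n : ℕ) (a : IntRing) : Finset GenericField :=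
  (Finset.range n).image fun i => (logisticMap genericR)^[i] (a : GenericField)

lemma mem_cycles_iff {n : ℕ} (hn : 0 < n) {t : Finset GenericField} :
    t ∈ cycles genericR n ↔
      ∃ a : IntRing, minimalPeriod (logisticMap intR) a = n ∧ t = orbitSet n a := by
  constructor
  · rintro ⟨x, hx, rfl⟩
    obtain ⟨a, rfl⟩ := exists_intRing_of_iterate_eq hn (x := x) (by
      conv_lhs => rw [← hx]
      exact iterate_minimalPeriod)
    exact ⟨a, by rw [← minimalPeriod_coe, hx], rfl⟩
  · rintro ⟨a, ha, rfl⟩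
    exact ⟨a, by rw [minimalPeriod_coe, ha], rfl⟩

lemma injOn_orbit {n : ℕ} {a : IntRing} (ha : minimalPeriod (logisticMap intR) a = n) :
    Set.InjOn (fun i => (logisticMap genericR)^[i] (a : GenericField)) (Finset.range n) := by
  have := iterate_injOn_Iio_minimalPeriod (f := logisticMap genericR) (x := (a : GenericField))
  rw [minimalPeriod_coe, ha] at this
  simpa [Set.InjOn] using this

lemma cycleMultiplier_orbitSet {n : ℕ} {a : IntRing}
    (ha : minimalPeriod (logisticMap intR) a = n) :
    cycleMultiplier (orbitSet n a) = (orbitMul intR n a : IntRing) := by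
  classical
  rw [cycleMultiplier, orbitSet, Finset.prod_image (injOn_orbit ha), coe_orbitMul, orbitMul]

lemma card_orbitSet {n : ℕ} {a : IntRing} (ha : minimalPeriod (logisticMap intR) a = n) :
    (orbitSet n a).card = n := by
  classical
  rw [orbitSet, Finset.card_image_of_injOn (injOn_orbit ha), Finset.card_range]

lemma minimalPeriod_iterate_eq {B : Type*} {f : B → B} {n : ℕ} (hn : 0 < n) {a : B}
    (ha : minimalPeriod f a = n) (j : ℕ) : minimalPeriod f (f^[j] a) = n := by
  rw [minimalPeriod_apply_iterate (minimalPeriod_pos_iff_mem_periodicPts.1 (by omega)), ha]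

lemma orbitSet_iterate {n : ℕ} (hn : 0 < n) {a : IntRing}
    (ha : minimalPeriod (logisticMap intR) a = n) (j : ℕ) :
    orbitSet n ((logisticMap intR)^[j] a) = orbitSet n a := by
  apply Finset.eq_of_subset_of_card_le
  · intro r hr
    simp only [orbitSet, Finset.mem_image, Finset.mem_range] at hr ⊢
    obtain ⟨i, -, rfl⟩ := hr
    refine ⟨(i + j) % n, Nat.mod_lt _ hn, ?_⟩
    rw [coe_iterate_intRing, ← iterate_add_apply]
    have := iterate_mod_minimalPeriod_eq (f := logisticMap genericR) (x := (a : GenericField))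
      (n := i + j)
    rwa [minimalPeriod_coe, ha] at this
  · rw [card_orbitSet ha, card_orbitSet (minimalPeriod_iterate_eq hn ha j)]

lemma algebraMap_cyclePolyAt (n : ℕ) (z : ℂ) :
    algebraMap ℂ[X] GenericField (cyclePolyAt n z) = ∏ t ∈ (cycles_finite n).toFinset,
      (algebraMap ℂ[X] GenericField (C z) - cycleMultiplier t) := by
  rw [cyclePolyAt, ← eval_map_apply, cyclePoly_spec, eval_prod]
  simp only [eval_sub, eval_X, eval_C]

lemma cyclePolyAt_ne_zero {n : ℕ} (hn : 0 < n) {z : ℂ} (hz : ‖z‖ = 1) : cyclePolyAt n z ≠ 0 := by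
  intro h
  have h1 := algebraMap_cyclePolyAt n z
  rw [h, map_zero, eq_comm, Finset.prod_eq_zero_iff] at h1
  obtain ⟨t, ht, h1⟩ := h1
  rw [Set.Finite.mem_toFinset, mem_cycles_iff hn] at ht
  obtain ⟨a, ha, rfl⟩ := ht
  rw [cycleMultiplier_orbitSet ha, sub_eq_zero, ← coe_algebraMap_intRing] at h1
  exact orbitMul_intR_ne hn (by rw [← ha]; exact iterate_minimalPeriod) hz
    (Subtype.coe_injective h1).symm

lemma norm_exp_root (k c : ℕ) :
    ‖Complex.exp (2 * k * Real.pi * Complex.I / c)‖ = 1 := by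
  have : (2 * k * Real.pi * Complex.I / c : ℂ) = ((2 * k * Real.pi / c : ℝ) : ℂ) * Complex.I := by
    push_cast; ring
  rw [this, Complex.norm_exp_ofReal_mul_I]

lemma exp_root_eq (k c : ℕ) : Complex.exp (2 * k * Real.pi * Complex.I / c) =
    Complex.exp (2 * Real.pi * Complex.I * (k / c)) := by
  congr 1; ring

lemma isPrimitiveRoot_exp_root {k c : ℕ} (hc : 1 < c) (hk : Nat.Coprime k c) :
    IsPrimitiveRoot (Complex.exp (2 * k * Real.pi * Complex.I / c)) c := by
  rw [exp_root_eq]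
  exact Complex.isPrimitiveRoot_exp_of_coprime k c (by omega) hk

lemma exists_exp_root {c : ℕ} (hc : 1 < c) {μ : ℂ} (hμ : IsPrimitiveRoot μ c) :
    ∃ k ∈ (Finset.Icc 1 c).filter (fun k => Nat.Coprime k c),
      Complex.exp (2 * k * Real.pi * Complex.I / c) = μ := by
  obtain ⟨k, hk, hkc, h⟩ := (Complex.isPrimitiveRoot_iff μ c (by omega)).1 hμ
  refine ⟨k, ?_, by rw [exp_root_eq, h]⟩
  rw [Finset.mem_filter, Finset.mem_Icc]
  refine ⟨⟨Nat.pos_of_ne_zero ?_, hk.le⟩, hkc⟩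
  rintro rfl
  rw [Nat.coprime_zero_left] at hkc
  omega

lemma exp_root_inj {c k k' : ℕ} (hc : 1 < c)
    (hk : k ∈ (Finset.Icc 1 c).filter (fun k => Nat.Coprime k c))
    (hk' : k' ∈ (Finset.Icc 1 c).filter (fun k => Nat.Coprime k c))
    (h : Complex.exp (2 * k * Real.pi * Complex.I / c) =
      Complex.exp (2 * k' * Real.pi * Complex.I / c)) : k = k' := by
  -- As c > 1, coprimality rules out the end point m = c.
  have hlt : ∀ m ∈ (Finset.Icc 1 c).filter (fun k => Nat.Coprime k c), m < c := by
    intro m hm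
    rw [Finset.mem_filter, Finset.mem_Icc] at hm
    refine lt_of_le_of_ne hm.1.2 ?_
    rintro rfl
    have := (Nat.coprime_self _).1 hm.2
    omega
  have hpow : ∀ m : ℕ, Complex.exp (2 * m * Real.pi * Complex.I / c) =
      Complex.exp (2 * Real.pi * Complex.I / c) ^ m := by
    intro m
    rw [← Complex.exp_nat_mul]
    congr 1
    ring
  rw [hpow, hpow] at h
  exact (Complex.isPrimitiveRoot_exp c (by omega)).pow_inj (hlt k hk) (hlt k' hk') h

lemma branchedFactor_ne_zero {n : ℕ} (hn : 0 < n) : branchedFactor n ≠ 0 := by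
  refine Finset.prod_ne_zero_iff.2 fun p hp => Finset.prod_ne_zero_iff.2 fun k hk =>
    cyclePolyAt_ne_zero ?_ (norm_exp_root _ _)
  have h1 := Nat.mem_divisorsAntidiagonal.1 (Finset.mem_filter.1 hp).1
  exact Nat.pos_of_ne_zero fun h => hn.ne' (by rw [← h1.1, h, mul_zero])

namespace Specialization

variable {R₀ : ℂ} (s : Specialization R₀)

/-- The valuation of the dominating valuation ring. -/
def val (a : IntRing) : s.ring.ValueGroup := s.ring.valuation a

lemma val_mul (a b : IntRing) : s.val (a * b) = s.val a * s.val b := by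
  simp [val]

lemma val_prod {ι : Type*} (T : Finset ι) (f : ι → IntRing) :
    s.val (∏ i ∈ T, f i) = ∏ i ∈ T, s.val (f i) := by
  simp [val]

lemma val_neg (a : IntRing) : s.val (-a) = s.val a := by
  simp [val, Valuation.map_neg]

lemma val_sub_comm (a b : IntRing) : s.val (a - b) = s.val (b - a) := by
  rw [← s.val_neg, neg_sub]

lemma val_eq_one_iff (a : IntRing) : s.val a = 1 ↔ s.red a ≠ 0 :=
  ⟨fun h h0 => (s.val_lt_one a h0).ne h, s.val_eq_one a⟩

lemma val_le_one (a : IntRing) : s.val a ≤ 1 := by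
  by_cases h : s.red a = 0
  · exact (s.val_lt_one a h).le
  · exact (s.val_eq_one a h).le

lemma val_eq_zero_iff (a : IntRing) : s.val a = 0 ↔ a = 0 := by
  simp [val]

/-- On ℂ[R] the valuation is t ^ (order at R₀) with 0 < t < 1, because the cofactor of the power of
R - R₀ is a unit. Orders can thus be compared in the large ring. -/
lemma rootMultiplicity_eq_of_val_eq {p q : ℂ[X]} (hp : p ≠ 0) (hq : q ≠ 0)
    (h : s.val (algebraMap ℂ[X] IntRing p) = s.val (algebraMap ℂ[X] IntRing q)) :
    p.rootMultiplicity R₀ = q.rootMultiplicity R₀ := by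
  set t := s.val (algebraMap ℂ[X] IntRing (X - C R₀)) with ht
  have ht1 : t < 1 := s.val_lt_one _ (by rw [s.red_algebraMap]; simp)
  have ht0 : t ≠ 0 := by
    rw [ht, Ne, s.val_eq_zero_iff, map_eq_zero_iff _ algebraMap_intRing_injective]
    exact X_sub_C_ne_zero R₀
  have key : ∀ p : ℂ[X], p ≠ 0 →
      s.val (algebraMap ℂ[X] IntRing p) = t ^ p.rootMultiplicity R₀ := by
    intro p hp
    obtain ⟨r, hr, hrx⟩ := exists_eq_pow_rootMultiplicity_mul_and_not_dvd p hp R₀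
    rw [dvd_iff_isRoot, IsRoot.def] at hrx
    conv_lhs => rw [hr]
    rw [map_mul, map_pow, s.val_mul,
      (s.val_eq_one_iff (algebraMap ℂ[X] IntRing r)).2 (by rw [s.red_algebraMap]; exact hrx),
      mul_one, ht]
    simp [val]
  rw [key p hp, key q hq] at h
  exact (pow_right_strictAnti₀ (zero_lt_iff.2 ht0) ht1).injective h

/-- The reductions of the generic multipliers are the zeros of the specialized cycle polynomial. -/
lemma eval_cyclePolyAt_eq_zero_iff {d : ℕ} (hd : 0 < d) (z : ℂ) :
    (cyclePolyAt d z).eval R₀ = 0 ↔ ∃ a : IntRing, minimalPeriod (logisticMap intR) a = d ∧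
      orbitMul R₀ d (s.red a) = z := by
  classical
  have hval : s.val (algebraMap ℂ[X] IntRing (cyclePolyAt d z)) =
      ∏ t ∈ (cycles_finite d).toFinset,
        s.ring.valuation (algebraMap ℂ[X] GenericField (C z) - cycleMultiplier t) := by
    rw [val, coe_algebraMap_intRing, algebraMap_cyclePolyAt, map_prod]
  have hfac : ∀ a : IntRing, minimalPeriod (logisticMap intR) a = d →
      s.ring.valuation (algebraMap ℂ[X] GenericField (C z) - cycleMultiplier (orbitSet d a)) =
        s.val (algebraMap ℂ[X] IntRing (C z) - orbitMul intR d a) := by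
    intro a ha
    rw [cycleMultiplier_orbitSet ha]; rfl
  have hred : ∀ a : IntRing, s.red (algebraMap ℂ[X] IntRing (C z) - orbitMul intR d a) =
      z - orbitMul R₀ d (s.red a) := by
    intro a
    rw [map_sub, s.red_algebraMap, s.red_orbitMul, eval_C]
  rw [← s.red_algebraMap, ← not_iff_not, ← ne_eq, ← s.val_eq_one_iff, hval]
  constructor
  · rintro h ⟨a, ha, haz⟩
    have hmem : orbitSet d a ∈ (cycles_finite d).toFinset := by
      rw [Set.Finite.mem_toFinset, mem_cycles_iff hd]; exact ⟨a, ha, rfl⟩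
    rw [← Finset.mul_prod_erase _ _ hmem, hfac a ha] at h
    have h1 : s.val (algebraMap ℂ[X] IntRing (C z) - orbitMul intR d a) < 1 :=
      s.val_lt_one _ (by rw [hred, haz, sub_self])
    refine (lt_of_le_of_lt (mul_le_of_le_one_right' (Finset.prod_le_one' fun t ht => ?_)) h1).ne h
    have ht := Finset.mem_of_mem_erase ht
    rw [Set.Finite.mem_toFinset, mem_cycles_iff hd] at ht
    obtain ⟨b, hb, rfl⟩ := ht
    rw [hfac b hb]
    exact s.val_le_one _
  · intro h
    refine Finset.prod_eq_one fun t ht => ?_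
    rw [Set.Finite.mem_toFinset, mem_cycles_iff hd] at ht
    obtain ⟨b, hb, rfl⟩ := ht
    rw [hfac b hb, s.val_eq_one_iff, hred, sub_ne_zero]
    exact fun hz => h ⟨b, hb, hz.symm⟩

/-- If a single cycle has multiplier reducing to `z`, it determines the valuation. -/
lemma val_cyclePolyAt_of_unique {d : ℕ} (hd : 0 < d) (z : ℂ) {a : IntRing}
    (ha : minimalPeriod (logisticMap intR) a = d)
    (huniq : ∀ b : IntRing, minimalPeriod (logisticMap intR) b = d →
      orbitMul R₀ d (s.red b) = z → orbitSet d b = orbitSet d a) :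
    s.val (algebraMap ℂ[X] IntRing (cyclePolyAt d z)) =
      s.val (algebraMap ℂ[X] IntRing (C z) - orbitMul intR d a) := by
  rw [val, coe_algebraMap_intRing, algebraMap_cyclePolyAt, map_prod,
    Finset.prod_eq_single_of_mem (orbitSet d a), cycleMultiplier_orbitSet ha]
  · rfl
  · rw [Set.Finite.mem_toFinset, mem_cycles_iff hd]; exact ⟨a, ha, rfl⟩
  · intro t ht hta
    rw [Set.Finite.mem_toFinset, mem_cycles_iff hd] at ht
    obtain ⟨b, hb, rfl⟩ := ht
    rw [cycleMultiplier_orbitSet hb]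
    refine s.val_eq_one (algebraMap ℂ[X] IntRing (C z) - orbitMul intR d b) ?_
    rw [map_sub, s.red_algebraMap, s.red_orbitMul, eval_C, sub_ne_zero]
    exact fun h => hta (huniq b hb h.symm)

lemma exists_lift_of_minimalPeriod {d : ℕ} (hd : 0 < d) {x : ℂ}
    (hx : minimalPeriod (logisticMap R₀) x = d) :
    ∃ y : IntRing, minimalPeriod (logisticMap intR) y = d ∧ s.red y = x := by
  obtain ⟨y, hy, hyx⟩ := s.exists_fixedPt hd (x := x) (by
    conv_lhs => rw [← hx]
    exact iterate_minimalPeriod)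
  refine ⟨y, Nat.dvd_antisymm (IsPeriodicPt.minimalPeriod_dvd hy) ?_, hyx⟩
  rw [← hx, ← hyx]
  exact s.minimalPeriod_red_dvd y

/-- A generic cycle does not collapse if its multiplier does not reduce to one. -/
lemma minimalPeriod_red_of_ne_one {d : ℕ} (hd : 0 < d) {a : IntRing}
    (ha : minimalPeriod (logisticMap intR) a = d) (h1 : orbitMul R₀ d (s.red a) ≠ 1) :
    minimalPeriod (logisticMap R₀) (s.red a) = d := by
  have hdvd := s.minimalPeriod_red_dvd a
  rw [ha] at hdvd
  by_contra hne
  have hlt := lt_of_le_of_ne (Nat.le_of_dvd hd hdvd) hne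
  have h2 := s.isPrimitiveRoot_of_collapse hd ha rfl hlt
  apply h1
  have h3 := orbitMul_mul R₀ (a := s.red a) iterate_minimalPeriod
    (d / minimalPeriod (logisticMap R₀) (s.red a))
  rwa [h2.pow_eq_one, Nat.mul_div_cancel' hdvd] at h3

/-- A zero means a d-cycle whose multiplier is a primitive c-th root of unity with c > 1; such
cycles match collapses by `exists_collapse` and `isPrimitiveRoot_of_collapse`. -/
lemma isRoot_branchedFactor_iff {n : ℕ} (hn : 0 < n) :
    (branchedFactor n).IsRoot R₀ ↔ ∃ a : IntRing, minimalPeriod (logisticMap intR) a = n ∧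
      minimalPeriod (logisticMap R₀) (s.red a) < n := by
  rw [IsRoot.def, branchedFactor, eval_prod, Finset.prod_eq_zero_iff]
  simp only [eval_prod, Finset.prod_eq_zero_iff]
  constructor
  · rintro ⟨⟨c, d⟩, hp, k, hk, h⟩
    rw [Finset.mem_filter, Nat.mem_divisorsAntidiagonal] at hp
    obtain ⟨⟨hcd, -⟩, hc⟩ := hp
    simp only at hcd hc hk h
    have hd : 0 < d := Nat.pos_of_ne_zero (by rintro rfl; omega)
    obtain ⟨a, ha, haz⟩ := (s.eval_cyclePolyAt_eq_zero_iff hd _).1 h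
    have hprim := isPrimitiveRoot_exp_root hc (Finset.mem_filter.1 hk).2
    rw [← haz] at hprim
    have hper := s.minimalPeriod_red_of_ne_one hd ha (fun h1 => by
      rw [h1] at hprim
      exact hc.ne' (hprim.unique IsPrimitiveRoot.one))
    obtain ⟨b, hb, hba⟩ := s.exists_collapse hd hc hper hprim
    refine ⟨b, by rw [hb, mul_comm, hcd], ?_⟩
    rw [hba, hper, ← hcd]
    nlinarith
  · rintro ⟨a, ha, hlt⟩
    have hdvd := s.minimalPeriod_red_dvd a
    rw [ha] at hdvd
    set d := minimalPeriod (logisticMap R₀) (s.red a) with hd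
    have hd0 : 0 < d := Nat.pos_of_dvd_of_pos hdvd hn
    obtain ⟨c, hc⟩ := hdvd
    have hc1 : 1 < c := by
      by_contra hcon
      have : d * c ≤ d * 1 := Nat.mul_le_mul_left _ (by omega)
      omega
    have hprim := s.isPrimitiveRoot_of_collapse hn ha hd.symm hlt
    have hnd : n / d = c := by rw [hc, Nat.mul_div_cancel_left _ hd0]
    rw [hnd] at hprim
    obtain ⟨k, hk, hkμ⟩ := exists_exp_root hc1 hprim
    obtain ⟨y, hy, hyx⟩ := s.exists_lift_of_minimalPeriod hd0 hd.symm
    refine ⟨(c, d), ?_, k, hk, ?_⟩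
    · rw [Finset.mem_filter, Nat.mem_divisorsAntidiagonal]
      exact ⟨⟨by rw [hc, mul_comm], hn.ne'⟩, hc1⟩
    · rw [s.eval_cyclePolyAt_eq_zero_iff hd0]
      exact ⟨y, hy, by rw [hkμ, hyx]⟩

/-! ### Petal count and valuations at a collapse -/

/-- The c points f^(dj)(a) and the generic point of period d over the same complex point are
distinct and merge there. -/
lemma le_card_of_collapse {d c : ℕ} (hd : 0 < d) (hc : 1 < c) {a : IntRing}
    (ha : minimalPeriod (logisticMap intR) a = d * c)
    (hx : minimalPeriod (logisticMap R₀) (s.red a) = d) :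
    c + 1 ≤ ((fixedPts (d * c)).filter fun q => s.red q = s.red a).card := by
  classical
  have hn : 0 < d * c := by positivity
  have hdn : d < d * c := by nlinarith
  obtain ⟨y, hy, hyx⟩ := s.exists_lift_of_minimalPeriod hd hx
  have hyd : (logisticMap intR)^[d] y = y := by rw [← hy]; exact iterate_minimalPeriod
  have hxd : (logisticMap R₀)^[d] (s.red a) = s.red a := by
    conv_lhs => rw [← hx]
    exact iterate_minimalPeriod
  have hinj : Set.InjOn (fun j => (logisticMap intR)^[d * j] a) (Finset.range c) := by
    intro i hi j hj h
    rw [Finset.mem_coe, Finset.mem_range] at hi hj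
    have h1 := iterate_injOn_Iio_minimalPeriod (f := logisticMap intR) (x := a)
      (by rw [ha]; exact Nat.mul_lt_mul_of_pos_left hi hd)
      (by rw [ha]; exact Nat.mul_lt_mul_of_pos_left hj hd) h
    exact Nat.eq_of_mul_eq_mul_left hd h1
  have hynot : y ∉ (Finset.range c).image fun j => (logisticMap intR)^[d * j] a := by
    rw [Finset.mem_image]
    rintro ⟨j, -, h⟩
    have h1 := minimalPeriod_iterate_eq hn ha (d * j)
    rw [h, hy] at h1
    omega
  have hcard := Finset.card_insert_of_notMem hynot
  rw [Finset.card_image_of_injOn hinj, Finset.card_range] at hcard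
  rw [← hcard]
  refine Finset.card_le_card fun q hq => ?_
  rw [Finset.mem_filter, mem_fixedPts hn]
  rw [Finset.mem_insert, Finset.mem_image] at hq
  rcases hq with rfl | ⟨j, -, rfl⟩
  · exact ⟨IsPeriodicPt.mul_const hyd c, hyx⟩
  · refine ⟨?_, ?_⟩
    · rw [← iterate_add_apply, add_comm, iterate_add_apply]
      congr 1
      rw [← ha]
      exact iterate_minimalPeriod
    · rw [s.red_iterate]
      exact IsPeriodicPt.mul_const hxd j

lemma minimalPeriod_red_iterate {d : ℕ} (hd : 0 < d) {a : IntRing}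
    (hx : minimalPeriod (logisticMap R₀) (s.red a) = d) (i : ℕ) :
    minimalPeriod (logisticMap R₀) (s.red ((logisticMap intR)^[i] a)) = d := by
  rw [s.red_iterate, minimalPeriod_iterate_eq hd hx]

lemma injOn_red_orbit {d : ℕ} {x : ℂ} (hx : minimalPeriod (logisticMap R₀) x = d) :
    Set.InjOn (fun i => (logisticMap R₀)^[i] x) (Finset.range d) := by
  have := iterate_injOn_Iio_minimalPeriod (f := logisticMap R₀) (x := x)
  rw [hx] at this
  simpa [Set.InjOn] using this

lemma le_rootMultiplicity_of_collapse {d c : ℕ} (hd : 0 < d) (hc : 1 < c) {a : IntRing}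
    (ha : minimalPeriod (logisticMap intR) a = d * c)
    (hx : minimalPeriod (logisticMap R₀) (s.red a) = d) (i : ℕ) :
    c ≤ (periodPoly (d * c) R₀).rootMultiplicity ((logisticMap R₀)^[i] (s.red a)) - 1 := by
  have hn : 0 < d * c := by positivity
  have h := s.le_card_of_collapse hd hc (minimalPeriod_iterate_eq hn ha i)
    (s.minimalPeriod_red_iterate hd hx i)
  rw [← s.rootMultiplicity_periodPoly hn, s.red_iterate] at h
  omega

/-- At a collapse there is no room for further generic points near the short cycle. -/
lemma card_eq_of_collapse {d c : ℕ} (hd : 0 < d) (hc : 1 < c) {a : IntRing}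
    (ha : minimalPeriod (logisticMap intR) a = d * c)
    (hx : minimalPeriod (logisticMap R₀) (s.red a) = d) :
    ((fixedPts (d * c)).filter fun q => s.red q = s.red a).card = c + 1 := by
  classical
  have hn : 0 < d * c := by positivity
  refine le_antisymm ?_ (s.le_card_of_collapse hd hc ha hx)
  rw [← s.rootMultiplicity_periodPoly hn]
  by_contra! hlt
  have hsum := sum_rootMultiplicity_sub_one_le hn R₀
    ((Finset.range d).image fun i => (logisticMap R₀)^[i] (s.red a))
  rw [Finset.sum_image (injOn_red_orbit hx)] at hsum
  -- Each of the d points carries at least c petals, and d c = n is already the maximum; one more is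
  -- impossible.
  have h2 : ∑ _i ∈ Finset.range d, c < ∑ i ∈ Finset.range d,
      ((periodPoly (d * c) R₀).rootMultiplicity ((logisticMap R₀)^[i] (s.red a)) - 1) :=
    Finset.sum_lt_sum (fun i _ => s.le_rootMultiplicity_of_collapse hd hc ha hx i)
      ⟨0, Finset.mem_range.2 hd, by rw [iterate_zero, id]; omega⟩
  rw [Finset.sum_const, Finset.card_range, smul_eq_mul] at h2
  omega

/-- At a collapse there is no other cycle with multiplier one of the `n`-th iterate. -/
lemma exists_iterate_eq_of_collapse {d c : ℕ} (hd : 0 < d) (hc : 1 < c) {a : IntRing}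
    (ha : minimalPeriod (logisticMap intR) a = d * c)
    (hx : minimalPeriod (logisticMap R₀) (s.red a) = d) {z : ℂ}
    (hz : (logisticMap R₀)^[d * c] z = z) (hz1 : orbitMul R₀ (d * c) z = 1) :
    ∃ i < d, (logisticMap R₀)^[i] (s.red a) = z := by
  classical
  have hn : 0 < d * c := by positivity
  by_contra! hno
  have hnot : z ∉ (Finset.range d).image fun i => (logisticMap R₀)^[i] (s.red a) := by
    rw [Finset.mem_image]
    rintro ⟨i, hi, h⟩
    exact hno i (Finset.mem_range.1 hi) h
  have hsum := sum_rootMultiplicity_sub_one_le hn R₀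
    (insert z ((Finset.range d).image fun i => (logisticMap R₀)^[i] (s.red a)))
  rw [Finset.sum_insert hnot, Finset.sum_image (injOn_red_orbit hx)] at hsum
  have h2 : ∑ _i ∈ Finset.range d, c ≤ ∑ i ∈ Finset.range d,
      ((periodPoly (d * c) R₀).rootMultiplicity ((logisticMap R₀)^[i] (s.red a)) - 1) :=
    Finset.sum_le_sum fun i _ => s.le_rootMultiplicity_of_collapse hd hc ha hx i
  rw [Finset.sum_const, Finset.card_range, smul_eq_mul] at h2
  -- Multiplier 1 makes z a multiple root, hence the base of a petal beyond the n that the collapsed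
  -- cycle uses.
  have h3 : 1 < (periodPoly (d * c) R₀).rootMultiplicity z := by
    rw [one_lt_rootMultiplicity_iff_isRoot (periodPoly_ne_zero hn R₀), IsRoot.def, IsRoot.def,
      eval_derivative_periodPoly, eval_periodPoly, hz, hz1, sub_self, sub_self]
    exact ⟨rfl, rfl⟩
  omega

/-- Every generic fixed point of the iterate with multiplier reducing to one has an iterate with the
same reduction as the collapsing point. -/
lemma exists_iterate_red_eq {d c : ℕ} (hd : 0 < d) (hc : 1 < c) {a b : IntRing}
    (ha : minimalPeriod (logisticMap intR) a = d * c)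
    (hx : minimalPeriod (logisticMap R₀) (s.red a) = d)
    (hb : (logisticMap intR)^[d * c] b = b) (hb1 : orbitMul R₀ (d * c) (s.red b) = 1) :
    (∃ i, (logisticMap R₀)^[i] (s.red a) = s.red b) ∧
      ∃ j, s.red ((logisticMap intR)^[j] b) = s.red a := by
  obtain ⟨i, hi, h⟩ := s.exists_iterate_eq_of_collapse hd hc ha hx
    (by rw [← s.red_iterate, hb]) hb1
  refine ⟨⟨i, h⟩, d - i, ?_⟩
  rw [s.red_iterate, ← h, ← iterate_add_apply, Nat.sub_add_cancel hi.le]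
  conv_lhs => rw [← hx]
  exact iterate_minimalPeriod

/-- The points that reduce to the same point as a collapsing point. -/
lemma eq_of_red_eq_collapse {d c : ℕ} (hd : 0 < d) (hc : 1 < c) {a y : IntRing}
    (ha : minimalPeriod (logisticMap intR) a = d * c)
    (hx : minimalPeriod (logisticMap R₀) (s.red a) = d)
    (hy : minimalPeriod (logisticMap intR) y = d) (hya : s.red y = s.red a) {q : IntRing}
    (hq : (logisticMap intR)^[d * c] q = q) (hqa : s.red q = s.red a) :
    q = y ∨ ∃ j < c, q = (logisticMap intR)^[d * j] a := by
  classical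
  have hn : 0 < d * c := by positivity
  have hdn : d < d * c := by nlinarith
  have hyd : (logisticMap intR)^[d] y = y := by
    conv_lhs => rw [← hy]
    exact iterate_minimalPeriod
  have hxd : (logisticMap R₀)^[d] (s.red a) = s.red a := by
    conv_lhs => rw [← hx]
    exact iterate_minimalPeriod
  have hinj : Set.InjOn (fun j => (logisticMap intR)^[d * j] a) (Finset.range c) := by
    intro i hi j hj h
    rw [Finset.mem_coe, Finset.mem_range] at hi hj
    have h1 := iterate_injOn_Iio_minimalPeriod (f := logisticMap intR) (x := a)
      (by rw [ha]; exact Nat.mul_lt_mul_of_pos_left hi hd)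
      (by rw [ha]; exact Nat.mul_lt_mul_of_pos_left hj hd) h
    exact Nat.eq_of_mul_eq_mul_left hd h1
  have hynot : y ∉ (Finset.range c).image fun j => (logisticMap intR)^[d * j] a := by
    rw [Finset.mem_image]
    rintro ⟨j, -, h⟩
    have h1 := minimalPeriod_iterate_eq hn ha (d * j)
    rw [h, hy] at h1
    omega
  have hcard := Finset.card_insert_of_notMem hynot
  rw [Finset.card_image_of_injOn hinj, Finset.card_range, ← s.card_eq_of_collapse hd hc ha hx]
    at hcard
  have heq := Finset.eq_of_subset_of_card_le (fun q hq => by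
    rw [Finset.mem_filter, mem_fixedPts hn]
    rw [Finset.mem_insert, Finset.mem_image] at hq
    rcases hq with rfl | ⟨j, -, rfl⟩
    · exact ⟨IsPeriodicPt.mul_const hyd c, hya⟩
    · refine ⟨?_, ?_⟩
      · rw [← iterate_add_apply, add_comm, iterate_add_apply]
        congr 1
        rw [← ha]
        exact iterate_minimalPeriod
      · rw [s.red_iterate]
        exact IsPeriodicPt.mul_const hxd j) hcard.ge
  have hmem : q ∈ (fixedPts (d * c)).filter fun q => s.red q = s.red a := by
    rw [Finset.mem_filter, mem_fixedPts hn]; exact ⟨hq, hqa⟩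
  rw [← heq, Finset.mem_insert, Finset.mem_image] at hmem
  rcases hmem with h | ⟨j, hj, h⟩
  · exact Or.inl h
  · exact Or.inr ⟨j, Finset.mem_range.1 hj, h.symm⟩

/-- In the product of `one_sub_orbitMul` every point with a different reduction contributes a unit.
-/
lemma val_one_sub_orbitMul {n : ℕ} (hn : 0 < n) {q₀ : IntRing}
    (hq₀ : (logisticMap intR)^[n] q₀ = q₀) {w : s.ring.ValueGroup}
    (hw : ∀ q, (logisticMap intR)^[n] q = q → s.red q = s.red q₀ → q ≠ q₀ →
      s.val (q₀ - q) = w) :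
    s.val (1 - orbitMul intR n q₀) =
      w ^ (((fixedPts n).filter fun q => s.red q = s.red q₀).card - 1) := by
  classical
  have hmem : q₀ ∈ (fixedPts n).filter fun q => s.red q = s.red q₀ := by
    rw [Finset.mem_filter, mem_fixedPts hn]; exact ⟨hq₀, rfl⟩
  rw [one_sub_orbitMul hn hq₀, s.val_prod, ← Finset.card_erase_of_mem hmem, ← Finset.prod_const]
  symm
  calc ∏ _q ∈ ((fixedPts n).filter fun q => s.red q = s.red q₀).erase q₀, w
      = ∏ q ∈ ((fixedPts n).filter fun q => s.red q = s.red q₀).erase q₀, s.val (q₀ - q) := by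
        refine Finset.prod_congr rfl fun q hq => ?_
        rw [Finset.mem_erase, Finset.mem_filter, mem_fixedPts hn] at hq
        exact (hw q hq.2.1 hq.2.2 hq.1).symm
    _ = _ := by
        refine Finset.prod_subset (Finset.erase_subset_erase _ (Finset.filter_subset _ _)) ?_
        intro q hq hqn
        rw [s.val_eq_one_iff, map_sub, sub_ne_zero]
        intro h
        apply hqn
        rw [Finset.mem_erase] at hq ⊢
        rw [Finset.mem_filter]
        exact ⟨hq.1, hq.2, h.symm⟩

/-- The two multipliers at a collapse approach their limits at the same rate. -/
lemma val_eq_of_collapse {d c : ℕ} (hd : 0 < d) (hc : 1 < c) {a y : IntRing}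
    (ha : minimalPeriod (logisticMap intR) a = d * c)
    (hx : minimalPeriod (logisticMap R₀) (s.red a) = d)
    (hy : minimalPeriod (logisticMap intR) y = d) (hya : s.red y = s.red a)
    (hμ : IsPrimitiveRoot (orbitMul R₀ d (s.red a)) c) :
    s.val (1 - orbitMul intR (d * c) a) =
      s.val (algebraMap ℂ[X] IntRing (C (orbitMul R₀ d (s.red a))) - orbitMul intR d y) := by
  have hn : 0 < d * c := by positivity
  set μ := orbitMul R₀ d (s.red a) with hμdef
  have had : (logisticMap intR)^[d * c] a = a := by
    conv_lhs => rw [← ha]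
    exact iterate_minimalPeriod
  have hyd : (logisticMap intR)^[d] y = y := by
    conv_lhs => rw [← hy]
    exact iterate_minimalPeriod
  have hyj : ∀ j, (logisticMap intR)^[d * j] y = y := fun j => IsPeriodicPt.mul_const hyd j
  have hxd : (logisticMap R₀)^[d] (s.red a) = s.red a := by
    conv_lhs => rw [← hx]
    exact iterate_minimalPeriod
  have hdq : ∀ j, s.red (diffQuot intR (d * j) a y) = μ ^ j := by
    intro j
    rw [s.red_diffQuot _ hya.symm, orbitMul_mul _ hxd]
  have hshift : ∀ j, (logisticMap intR)^[d * j] a - y = (a - y) * diffQuot intR (d * j) a y := by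
    intro j
    rw [← iterate_sub_iterate, hyj]
  -- The c points merging with a are y and the f^(dj)(a), 0 < j < c. All are as far from a as y is,
  -- because the difference quotients reduce to μ^j ≠ 1.
  have h1 : s.val (1 - orbitMul intR (d * c) a) = s.val (a - y) ^ c := by
    rw [s.val_one_sub_orbitMul hn had (w := s.val (a - y)), s.card_eq_of_collapse hd hc ha hx,
      Nat.add_sub_cancel]
    intro q hq hqa hne
    rcases s.eq_of_red_eq_collapse hd hc ha hx hy hya hq hqa with rfl | ⟨j, hj, rfl⟩
    · rfl
    · have h2 : a - (logisticMap intR)^[d * j] a = (a - y) * (1 - diffQuot intR (d * j) a y) := by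
        linear_combination -hshift j
      rw [h2, s.val_mul, (s.val_eq_one_iff (1 - diffQuot intR (d * j) a y)).2, mul_one]
      rw [map_sub, map_one, hdq, sub_ne_zero]
      refine (hμ.pow_ne_one_of_pos_of_lt ?_ hj).symm
      rintro rfl
      exact hne (by simp)
  -- Seen from y the other c points are the f^(dj)(a), and the difference quotients reduce to μ^j ≠
  -- 0.
  have h2 : s.val (1 - orbitMul intR (d * c) y) = s.val (a - y) ^ c := by
    rw [s.val_one_sub_orbitMul hn (hyj c) (w := s.val (a - y)), hya,
      s.card_eq_of_collapse hd hc ha hx, Nat.add_sub_cancel]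
    intro q hq hqy hne
    rcases s.eq_of_red_eq_collapse hd hc ha hx hy hya hq (hqy.trans hya) with rfl | ⟨j, hj, rfl⟩
    · exact absurd rfl hne
    · rw [s.val_sub_comm, hshift, s.val_mul, (s.val_eq_one_iff (diffQuot intR (d * j) a y)).2,
        mul_one]
      rw [hdq]
      exact pow_ne_zero _ (hμ.ne_zero (by omega))
  rw [h1, ← h2, orbitMul_mul _ hyd]
  set m : IntRing := algebraMap ℂ[X] IntRing (C μ) with hm
  set l := orbitMul intR d y with hl
  have hmc : m ^ c = 1 := by rw [hm, ← map_pow, ← C_pow, hμ.pow_eq_one, C_1, map_one]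
  have hredm : s.red m = μ := by rw [hm, s.red_algebraMap, eval_C]
  have hredl : s.red l = μ := by rw [hl, s.red_orbitMul, hya]
  -- Factoring m^c - l^c leaves a geometric sum that reduces to c μ^(c-1), which is nonzero.
  rw [← hmc, ← (Commute.all m l).mul_geom_sum₂ c, s.val_mul, (s.val_eq_one_iff (∑ i ∈ Finset.range c,
    m ^ i * l ^ (c - 1 - i))).2, mul_one]
  rw [map_sum]
  simp only [map_mul, map_pow, hredm, hredl]
  rw [Finset.sum_congr rfl (g := fun _ => μ ^ (c - 1))]
  · rw [Finset.sum_const, Finset.card_range, nsmul_eq_mul]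
    exact mul_ne_zero (by exact_mod_cast (by omega : c ≠ 0))
      (pow_ne_zero _ (hμ.ne_zero (by omega)))
  · intro i hi
    rw [Finset.mem_range] at hi
    rw [← pow_add]
    congr 1
    omega

/-- An n-cycle with multiplier reducing to 1 must pass over the collapsing point, where the only
points of period n are those of the orbit of a. So only one factor is not a unit. -/
lemma val_cyclePolyAt_of_collapse {d c : ℕ} (hd : 0 < d) (hc : 1 < c) {a : IntRing}
    (ha : minimalPeriod (logisticMap intR) a = d * c)
    (hx : minimalPeriod (logisticMap R₀) (s.red a) = d) :
    s.val (algebraMap ℂ[X] IntRing (cyclePolyAt (d * c) 1)) =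
      s.val (1 - orbitMul intR (d * c) a) := by
  have hn : 0 < d * c := by positivity
  have hdn : d < d * c := by nlinarith
  obtain ⟨y, hy, hya⟩ := s.exists_lift_of_minimalPeriod hd hx
  rw [s.val_cyclePolyAt_of_unique hn 1 ha]
  · simp
  · intro b hb hb1
    have hbn : (logisticMap intR)^[d * c] b = b := by
      conv_lhs => rw [← hb]
      exact iterate_minimalPeriod
    obtain ⟨-, j, hj⟩ := s.exists_iterate_red_eq hd hc ha hx hbn hb1
    rw [← orbitSet_iterate hn hb j]
    rcases s.eq_of_red_eq_collapse hd hc ha hx hy hya (q := (logisticMap intR)^[j] b)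
      (by rw [← iterate_add_apply, add_comm, iterate_add_apply, hbn]) hj with h | ⟨i, -, h⟩
    · have h1 := minimalPeriod_iterate_eq hn hb j
      rw [h, hy] at h1
      omega
    · rw [h, orbitSet_iterate hn ha]

lemma val_branchedFactor_of_collapse {d c : ℕ} (hd : 0 < d) (hc : 1 < c) {a y : IntRing}
    (ha : minimalPeriod (logisticMap intR) a = d * c)
    (hx : minimalPeriod (logisticMap R₀) (s.red a) = d)
    (hy : minimalPeriod (logisticMap intR) y = d) (hya : s.red y = s.red a)
    (hμ : IsPrimitiveRoot (orbitMul R₀ d (s.red a)) c) :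
    s.val (algebraMap ℂ[X] IntRing (branchedFactor (d * c))) =
      s.val (algebraMap ℂ[X] IntRing (C (orbitMul R₀ d (s.red a))) - orbitMul intR d y) := by
  have hn : 0 < d * c := by positivity
  have hxd : (logisticMap R₀)^[d] (s.red a) = s.red a := by
    conv_lhs => rw [← hx]
    exact iterate_minimalPeriod
  have hyd : (logisticMap intR)^[d] y = y := by
    conv_lhs => rw [← hy]
    exact iterate_minimalPeriod
  -- A primitive c'-th root of unity as multiplier on a d'-cycle gives multiplier 1 for f^n, so that
  -- cycle reduces to the collapsed one. Hence a single factor of a single cycle polynomial is not a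
  -- unit.
  have huniq : ∀ c' d' : ℕ, c' * d' = d * c → 1 < c' → ∀ ω : ℂ, IsPrimitiveRoot ω c' →
      ∀ b : IntRing, minimalPeriod (logisticMap intR) b = d' → orbitMul R₀ d' (s.red b) = ω →
        d' = d ∧ c' = c ∧ ω = orbitMul R₀ d (s.red a) ∧ orbitSet d' b = orbitSet d' y := by
    intro c' d' hcd hc' ω hω b hb hbω
    have hd' : 0 < d' := Nat.pos_of_ne_zero (by rintro rfl; omega)
    have hω1 : ω ≠ 1 := by
      rintro rfl
      exact hc'.ne' (hω.unique IsPrimitiveRoot.one)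
    have hbd : (logisticMap intR)^[d'] b = b := by
      conv_lhs => rw [← hb]
      exact iterate_minimalPeriod
    have hper := s.minimalPeriod_red_of_ne_one hd' hb (by rw [hbω]; exact hω1)
    have hbn : (logisticMap intR)^[d * c] b = b := by
      rw [← hcd, mul_comm]; exact IsPeriodicPt.mul_const hbd c'
    have hb1 : orbitMul R₀ (d * c) (s.red b) = 1 := by
      rw [← hcd, mul_comm, orbitMul_mul _ (by rw [← s.red_iterate, hbd]), hbω, hω.pow_eq_one]
    obtain ⟨⟨i, hi⟩, j, hj⟩ := s.exists_iterate_red_eq hd hc ha hx hbn hb1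
    have hdd : d' = d := by rw [← hper, ← hi, minimalPeriod_iterate_eq hd hx]
    subst hdd
    have hωμ : ω = orbitMul R₀ d' (s.red a) := by
      rw [← hbω, ← hi, orbitMul_iterate _ hxd]
    refine ⟨rfl, ?_, hωμ, ?_⟩
    · rw [mul_comm] at hcd
      exact Nat.eq_of_mul_eq_mul_left hd hcd
    · rw [← orbitSet_iterate hd hb j, s.eq_of_red_eq (d := d') (b := y) _ hyd (hj.trans hya.symm)]
      · rw [hj, ← hωμ]; exact hω1
      · rw [← iterate_add_apply, add_comm, iterate_add_apply, hbd]
  have hval1 : ∀ c' d' : ℕ, c' * d' = d * c → 1 < c' → ∀ ω : ℂ, IsPrimitiveRoot ω c' →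
      ¬ (c' = c ∧ ω = orbitMul R₀ d (s.red a)) →
        s.val (algebraMap ℂ[X] IntRing (cyclePolyAt d' ω)) = 1 := by
    intro c' d' hcd hc' ω hω hne
    have hd' : 0 < d' := Nat.pos_of_ne_zero (by rintro rfl; omega)
    rw [s.val_eq_one_iff, s.red_algebraMap, Ne, s.eval_cyclePolyAt_eq_zero_iff hd']
    rintro ⟨b, hb, hbω⟩
    have := huniq c' d' hcd hc' ω hω b hb hbω
    exact hne ⟨this.2.1, this.2.2.1⟩
  obtain ⟨k, hk, hkμ⟩ := exists_exp_root hc hμ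
  rw [branchedFactor, map_prod, s.val_prod, Finset.prod_eq_single_of_mem (c, d), map_prod,
    s.val_prod, Finset.prod_eq_single_of_mem k hk, hkμ, s.val_cyclePolyAt_of_unique hd _ hy]
  · intro b hb hbω
    exact (huniq c d (mul_comm _ _) hc _ hμ b hb hbω).2.2.2
  · intro k' hk' hne
    refine hval1 c d (mul_comm _ _) hc _ (isPrimitiveRoot_exp_root hc (Finset.mem_filter.1 hk').2)
      fun h => hne (exp_root_inj hc hk' hk ?_)
    rw [h.2, hkμ]
  · rw [Finset.mem_filter, Nat.mem_divisorsAntidiagonal]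
    exact ⟨⟨mul_comm _ _, hn.ne'⟩, hc⟩
  · rintro ⟨c', d'⟩ hp hne
    rw [Finset.mem_filter, Nat.mem_divisorsAntidiagonal] at hp
    obtain ⟨⟨hcd, -⟩, hc'⟩ := hp
    simp only at hcd hc'
    rw [map_prod, s.val_prod]
    refine Finset.prod_eq_one fun k' hk' => ?_
    refine hval1 c' d' hcd hc' _
      (isPrimitiveRoot_exp_root hc' (Finset.mem_filter.1 hk').2) fun h => hne ?_
    have h1 : c' = c := h.1
    subst h1
    rw [mul_comm] at hcd
    rw [Nat.eq_of_mul_eq_mul_right (by omega) hcd]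

end Specialization

/-- The data of a generic cycle that collapses at a zero of the removed factor. -/
lemma exists_collapse_of_isRoot {n : ℕ} (hn : 0 < n) {R₀ : ℂ} (s : Specialization R₀)
    (h : (branchedFactor n).IsRoot R₀) :
    ∃ d c : ℕ, n = d * c ∧ 0 < d ∧ 1 < c ∧ ∃ a : IntRing,
      minimalPeriod (logisticMap intR) a = n ∧ minimalPeriod (logisticMap R₀) (s.red a) = d ∧
        IsPrimitiveRoot (orbitMul R₀ d (s.red a)) c := by
  obtain ⟨a, ha, hlt⟩ := (s.isRoot_branchedFactor_iff hn).1 h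
  have hdvd := s.minimalPeriod_red_dvd a
  rw [ha] at hdvd
  have hprim := s.isPrimitiveRoot_of_collapse hn ha rfl hlt
  set d := minimalPeriod (logisticMap R₀) (s.red a) with hd
  have hd0 : 0 < d := Nat.pos_of_dvd_of_pos hdvd hn
  obtain ⟨c, hc⟩ := hdvd
  rw [hc, Nat.mul_div_cancel_left _ hd0] at hprim
  refine ⟨d, c, hc, hd0, ?_, a, ha, rfl, hprim⟩
  by_contra hcon
  have : d * c ≤ d * 1 := Nat.mul_le_mul_left _ (by omega)
  omega

lemma rootMultiplicity_eq_of_isRoot {n : ℕ} (hn : 0 < n) {R₀ : ℂ}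
    (h : (branchedFactor n).IsRoot R₀) :
    (branchedFactor n).rootMultiplicity R₀ = (cyclePolyAt n 1).rootMultiplicity R₀ := by
  obtain ⟨s⟩ := exists_specialization R₀
  obtain ⟨d, c, rfl, hd, hc, a, ha, hx, hμ⟩ := exists_collapse_of_isRoot hn s h
  obtain ⟨y, hy, hya⟩ := s.exists_lift_of_minimalPeriod hd hx
  refine s.rootMultiplicity_eq_of_val_eq (branchedFactor_ne_zero hn)
    (cyclePolyAt_ne_zero hn norm_one) ?_
  rw [s.val_branchedFactor_of_collapse hd hc ha hx hy hya hμ,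
    s.val_cyclePolyAt_of_collapse hd hc ha hx, s.val_eq_of_collapse hd hc ha hx hy hya hμ]

/-- A genuine n-cycle with multiplier 1 would coexist with a collapse, whereas the petals leave room
only for the collapsed cycle, of period d < n. -/
lemma not_isRoot_of_isOriginalOnset {n : ℕ} (hn : 0 < n) {R₀ : ℂ} (h : IsOriginalOnset n R₀) :
    ¬ (branchedFactor n).IsRoot R₀ := by
  intro hroot
  obtain ⟨s⟩ := exists_specialization R₀
  obtain ⟨d, c, rfl, hd, hc, a, ha, hx, -⟩ := exists_collapse_of_isRoot hn s hroot
  obtain ⟨z, hz, hz1⟩ := h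
  rw [(hasDerivAt_iterate _ _ _).deriv] at hz1
  obtain ⟨i, -, hi⟩ := s.exists_iterate_eq_of_collapse hd hc ha hx (z := z) (by
    conv_lhs => rw [← hz]
    exact iterate_minimalPeriod) hz1
  rw [← hi, minimalPeriod_iterate_eq hd hx] at hz
  nlinarith

lemma isRoot_or_isOriginalOnset {n : ℕ} (hn : 0 < n) {R₀ : ℂ} (h : (cyclePolyAt n 1).IsRoot R₀) :
    (branchedFactor n).IsRoot R₀ ∨ IsOriginalOnset n R₀ := by
  obtain ⟨s⟩ := exists_specialization R₀
  obtain ⟨a, ha, ha1⟩ := (s.eval_cyclePolyAt_eq_zero_iff hn 1).1 h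
  have hdvd := s.minimalPeriod_red_dvd a
  rw [ha] at hdvd
  rcases (Nat.le_of_dvd hn hdvd).lt_or_eq with hlt | heq
  · exact Or.inl ((s.isRoot_branchedFactor_iff hn).2 ⟨a, ha, hlt⟩)
  · exact Or.inr ⟨s.red a, heq, by rw [(hasDerivAt_iterate _ _ _).deriv, ha1]⟩

/-! ### The dynatomic polynomial and branching parameters -/

open Classical in
/-- The points of exact period `n` for the generic parameter. -/
def exactPts (n : ℕ) : Finset IntRing :=
  (fixedPts n).filter fun a => minimalPeriod (logisticMap intR) a = n

lemma mem_exactPts {n : ℕ} (hn : 0 < n) {a : IntRing} :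
    a ∈ exactPts n ↔ minimalPeriod (logisticMap intR) a = n := by
  classical
  rw [exactPts, Finset.mem_filter, mem_fixedPts hn, and_iff_right_iff_imp]
  intro h
  conv_lhs => rw [← h]
  exact iterate_minimalPeriod

lemma prod_divisors_exactPts {n : ℕ} (hn : 0 < n) :
    ∏ d ∈ n.divisors, ∏ a ∈ exactPts d, (X - C a) = genericPeriodPoly n := by
  classical
  rw [genericPeriodPoly_eq_prod hn, ← Finset.prod_fiberwise_of_maps_to (t := n.divisors)
    (g := fun a => minimalPeriod (logisticMap intR) a)]
  · refine Finset.prod_congr rfl fun d hd => Finset.prod_congr ?_ fun _ _ => rfl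
    have hdn := Nat.dvd_of_mem_divisors hd
    ext a
    rw [mem_exactPts (Nat.pos_of_mem_divisors hd), Finset.mem_filter, mem_fixedPts hn]
    refine ⟨fun h => ⟨?_, h⟩, fun h => h.2⟩
    exact (isPeriodicPt_iff_minimalPeriod_dvd.2 (h ▸ hdn))
  · intro a ha
    rw [mem_fixedPts hn] at ha
    exact Nat.mem_divisors.2 ⟨IsPeriodicPt.minimalPeriod_dvd ha, hn.ne'⟩

/-- The **dynatomic polynomial**: the monic polynomial whose roots are the generic points of exact
period `n` has its coefficients in `ℂ[R]`. -/
lemma exists_dynatomicPoly {n : ℕ} (hn : 0 < n) :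
    ∃ Φ : ℂ[X][X], Φ.map (algebraMap ℂ[X] IntRing) = ∏ a ∈ exactPts n, (X - C a) := by
  induction n using Nat.strong_induction_on with
  | _ n ih =>
    choose! Φ hΦ using ih
    have hmap : (∏ d ∈ n.properDivisors, Φ d).map (algebraMap ℂ[X] IntRing) =
        ∏ d ∈ n.properDivisors, ∏ a ∈ exactPts d, (X - C a) := by
      rw [Polynomial.map_prod]
      exact Finset.prod_congr rfl fun d hd =>
        hΦ d (Nat.mem_properDivisors.1 hd).2 (Nat.pos_of_mem_properDivisors hd)
    have hmonic' : (∏ d ∈ n.properDivisors, ∏ a ∈ exactPts d, (X - C a)).Monic :=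
      monic_prod_of_monic _ _ fun d _ => monic_prod_X_sub_C _ _
    have hmonic : (∏ d ∈ n.properDivisors, Φ d).Monic :=
      monic_of_injective algebraMap_intRing_injective (hmap ▸ hmonic')
    -- The factors for proper divisors are split off; division by a monic polynomial commutes with
    -- the map to `IntRing`.
    refine ⟨(X - iterPoly n) /ₘ ∏ d ∈ n.properDivisors, Φ d, ?_⟩
    rw [map_divByMonic _ hmonic, hmap, ← genericPeriodPoly, ← prod_divisors_exactPts hn,
      ← Nat.insert_self_properDivisors hn.ne', Finset.prod_insert Nat.self_notMem_properDivisors,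
      mul_comm, mul_divByMonic_cancel_left _ hmonic']

/-- Specializations at different parameters are chosen independently. A single Φ over ℂ[R] ties them
together and makes continuity in R available. -/
lemma Specialization.eval₂_dynatomic {R : ℂ} (s : Specialization R) {n : ℕ} {Φ : ℂ[X][X]}
    (hΦ : Φ.map (algebraMap ℂ[X] IntRing) = ∏ a ∈ exactPts n, (X - C a)) (x : ℂ) :
    Φ.eval₂ (evalRingHom R) x = ∏ a ∈ exactPts n, (x - s.red a) := by
  have hcomp : s.red.comp (algebraMap ℂ[X] IntRing) = evalRingHom R := by
    ext p <;> simp [s.red_algebraMap]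
  rw [← hcomp, ← eval_map, ← map_map, hΦ, Polynomial.map_prod, eval_prod]
  simp

lemma continuous_eval₂_evalRingHom (Φ : ℂ[X][X]) :
    Continuous fun q : ℂ × ℂ => Φ.eval₂ (evalRingHom q.1) q.2 := by
  simp only [eval₂_eq_sum_range, coe_evalRingHom]
  refine continuous_finsetSum _ fun i _ => ?_
  exact ((Φ.coeff i).continuous.comp continuous_fst).mul (continuous_snd.pow i)

/-- For R near R₀ the value of Φ at the collapsed point is small, so some root of Φ at R is near
that point. Avoiding the finitely many other zeros of `branchedFactor n` ensures that this root has
exact period n. -/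
lemma isBranchingParam_of_isRoot {n : ℕ} (hn : 0 < n) {R₀ : ℂ}
    (h : (branchedFactor n).IsRoot R₀) : IsBranchingParam n R₀ := by
  obtain ⟨s⟩ := exists_specialization R₀
  obtain ⟨a, ha, hlt⟩ := (s.isRoot_branchedFactor_iff hn).1 h
  have hdvd := s.minimalPeriod_red_dvd a
  rw [ha] at hdvd
  refine ⟨s.red a, hdvd, hlt, ?_⟩
  obtain ⟨Φ, hΦ⟩ := exists_dynatomicPoly hn
  rw [Metric.mem_closure_iff]
  intro ε hε
  have hzero : Φ.eval₂ (evalRingHom R₀) (s.red a) = 0 := by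
    rw [s.eval₂_dynatomic hΦ]
    exact Finset.prod_eq_zero ((mem_exactPts hn).2 ha) (sub_self _)
  have hcont : Filter.Tendsto (fun R => ‖Φ.eval₂ (evalRingHom R) (s.red a)‖) (nhds R₀) (nhds 0) := by
    have h1 : Continuous fun R : ℂ => ‖Φ.eval₂ (evalRingHom R) (s.red a)‖ :=
      ((continuous_eval₂_evalRingHom Φ).comp (continuous_id.prodMk continuous_const)).norm
    have h2 := h1.tendsto R₀
    rwa [hzero, norm_zero] at h2
  have hev1 : ∀ᶠ R in nhdsWithin R₀ {R₀}ᶜ,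
      ‖Φ.eval₂ (evalRingHom R) (s.red a)‖ < ε ^ (exactPts n).card :=
    (hcont.eventually_lt_const (by positivity)).filter_mono nhdsWithin_le_nhds
  have hev2 : ∀ᶠ R in nhdsWithin R₀ {R₀}ᶜ, ¬ (branchedFactor n).IsRoot R := by
    have hfin : ({R | (branchedFactor n).IsRoot R} \ {R₀}).Finite :=
      (finite_setOfPred_isRoot (branchedFactor_ne_zero hn)).sdiff
    have h1 : ({R | (branchedFactor n).IsRoot R} \ {R₀})ᶜ ∈ nhds R₀ :=
      hfin.isClosed.isOpen_compl.mem_nhds (by simp)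
    filter_upwards [nhdsWithin_le_nhds h1, self_mem_nhdsWithin] with R hR hne hroot
    exact hR ⟨hroot, hne⟩
  have hev3 : ∀ᶠ R in nhdsWithin R₀ {R₀}ᶜ, dist R₀ R < ε := by
    filter_upwards [nhdsWithin_le_nhds (Metric.ball_mem_nhds R₀ hε)] with R hR
    rwa [dist_comm]
  obtain ⟨R, hR1, hR2, hR3⟩ := (hev1.and (hev2.and hev3)).exists
  obtain ⟨s'⟩ := exists_specialization R
  rw [s'.eval₂_dynatomic hΦ, norm_prod] at hR1
  -- A product of N distances below ε^N has a factor below ε.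
  obtain ⟨b, hb, hbε⟩ : ∃ b ∈ exactPts n, ‖s.red a - s'.red b‖ < ε := by
    by_contra! hcon
    refine hR1.not_ge ?_
    rw [← Finset.prod_const]
    exact Finset.prod_le_prod (fun _ _ => hε.le) hcon
  rw [mem_exactPts hn] at hb
  refine ⟨(R, s'.red b), ?_, ?_⟩
  · have hdvd' := s'.minimalPeriod_red_dvd b
    rw [hb] at hdvd'
    by_contra hne
    exact hR2 ((s'.isRoot_branchedFactor_iff hn).2
      ⟨b, hb, lt_of_le_of_ne (Nat.le_of_dvd hn hdvd') hne⟩)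
  · rw [Prod.dist_eq]
    exact max_lt hR3 (by rw [dist_eq_norm]; exact hbε)

/-- The zero set of Φ is closed and contains all points of period n, so the limit point is the
reduction of a generic point of period n. Its period being smaller, that point has collapsed. -/
lemma isRoot_of_isBranchingParam {n : ℕ} (hn : 0 < n) {R₀ : ℂ} (h : IsBranchingParam n R₀) :
    (branchedFactor n).IsRoot R₀ := by
  obtain ⟨x, -, hlt, hcl⟩ := h
  obtain ⟨Φ, hΦ⟩ := exists_dynatomicPoly hn
  have hclosed : IsClosed {q : ℂ × ℂ | Φ.eval₂ (evalRingHom q.1) q.2 = 0} :=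
    isClosed_eq (continuous_eval₂_evalRingHom Φ) continuous_const
  have hsub : {q : ℂ × ℂ | minimalPeriod (logisticMap q.1) q.2 = n} ⊆
      {q : ℂ × ℂ | Φ.eval₂ (evalRingHom q.1) q.2 = 0} := by
    rintro ⟨R, z⟩ hz
    obtain ⟨s⟩ := exists_specialization R
    obtain ⟨y, hy, hyz⟩ := s.exists_lift_of_minimalPeriod hn hz
    change Φ.eval₂ (evalRingHom R) z = 0
    rw [s.eval₂_dynatomic hΦ]
    exact Finset.prod_eq_zero ((mem_exactPts hn).2 hy) (by rw [hyz, sub_self])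
  have hmem : Φ.eval₂ (evalRingHom R₀) x = 0 := closure_minimal hsub hclosed hcl
  obtain ⟨s⟩ := exists_specialization R₀
  rw [s.eval₂_dynatomic hΦ, Finset.prod_eq_zero_iff] at hmem
  obtain ⟨a, ha, hax⟩ := hmem
  refine (s.isRoot_branchedFactor_iff hn).2 ⟨a, (mem_exactPts hn).1 ha, ?_⟩
  rwa [← sub_eq_zero.1 hax]

/-! ### Divisibility and the quotient -/

lemma branchedFactor_dvd {n : ℕ} (hn : 0 < n) : branchedFactor n ∣ cyclePolyAt n 1 := by
  classical
  rw [IsAlgClosed.dvd_iff_roots_le_roots (branchedFactor_ne_zero hn)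
    (cyclePolyAt_ne_zero hn norm_one), Multiset.le_iff_count]
  intro R
  rw [count_roots, count_roots]
  by_cases h : (branchedFactor n).IsRoot R
  · exact (rootMultiplicity_eq_of_isRoot hn h).le
  · rw [rootMultiplicity_eq_zero h]
    exact Nat.zero_le _

/-- Orders add up: at a zero of the removed factor nothing is left for the quotient, elsewhere the
quotient keeps the full order. Original onsets are never zeros of the removed factor, and every
other zero of P_n(R, 1) is one. -/
lemma isOriginalFactor_div {n : ℕ} (hn : 0 < n) :
    IsOriginalFactor n (cyclePolyAt n 1 / branchedFactor n) := by
  have hP : cyclePolyAt n 1 ≠ 0 := cyclePolyAt_ne_zero hn norm_one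
  have hmul : branchedFactor n * (cyclePolyAt n 1 / branchedFactor n) = cyclePolyAt n 1 :=
    EuclideanDomain.mul_div_cancel' (branchedFactor_ne_zero hn) (branchedFactor_dvd hn)
  set S := cyclePolyAt n 1 / branchedFactor n with hS
  have hmult : ∀ R, (cyclePolyAt n 1).rootMultiplicity R =
      (branchedFactor n).rootMultiplicity R + S.rootMultiplicity R := by
    intro R
    rw [← rootMultiplicity_mul (by rwa [hmul]), hmul]
  refine ⟨?_, Dvd.intro_left _ hmul, fun R hR => ?_, fun R hR => ?_⟩
  · intro h
    rw [h, mul_zero] at hmul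
    exact hP hmul.symm
  · rw [hmult, rootMultiplicity_eq_zero (not_isRoot_of_isOriginalOnset hn hR), zero_add]
  · by_cases h : (branchedFactor n).IsRoot R
    · have h1 := hmult R
      rw [← rootMultiplicity_eq_of_isRoot hn h] at h1
      omega
    · have h1 := hmult R
      rw [rootMultiplicity_eq_zero fun h' => (isRoot_or_isOriginalOnset hn h').elim h hR] at h1
      omega

end LogisticCycles
end

theorem theorem7 (n : ℕ) (hn : 0 < n) :
    LogisticCycles.cyclePolyAt n 1 ≠ 0 ∧
    LogisticCycles.branchedFactor n ≠ 0 ∧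
    LogisticCycles.branchedFactor n ∣ LogisticCycles.cyclePolyAt n 1 ∧
    LogisticCycles.IsOriginalFactor n
      (LogisticCycles.cyclePolyAt n 1 / LogisticCycles.branchedFactor n) ∧
    ∀ R₀ : ℂ, (LogisticCycles.branchedFactor n).IsRoot R₀ ↔
      LogisticCycles.IsBranchingParam n R₀ :=
  ⟨LogisticCycles.cyclePolyAt_ne_zero hn norm_one, LogisticCycles.branchedFactor_ne_zero hn,
    LogisticCycles.branchedFactor_dvd hn, LogisticCycles.isOriginalFactor_div hn, fun _ =>
    ⟨LogisticCycles.isBranchingParam_of_isRoot hn, LogisticCycles.isRoot_of_isBranchingParam hn⟩⟩
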